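/- Let $\Lambda\subset\mathbb C$ be a lattice with Weierstrass functions $\wp,\wp',\sigma$, and put $$F(x_0,x_1;\alpha)=\frac{\sigma(x_0+x_1+\alpha)\,\sigma(x_0-x_1+\alpha)}{\sigma(x_0+x_1-\alpha)\,\sigma(x_0-x_1-\alpha)}.$$ The equation Q4 on a quadrilateral $(u_0,u_1,u_2,u_3)$ whose edges $u_0u_1,u_2u_3$ carry the parameter $\alpha$ and whose edges $u_0u_3,u_1u_2$ carry $\beta$ is $$A\big((u_0-b)(u_3-b)-(a-b)(c-b)\big)\big((u_1-b)(u_2-b)-(a-b)(c-b)\big)+B\big((u_0-a)(u_1-a)-(b-a)(c-a)\big)\big((u_3-a)(u_2-a)-(b-a)(c-a)\big)=ABC(a-b),$$ where $(a,A)=(\wp,\wp')(\alpha)$, $(b,B)=(\wp,\wp')(\beta)$, $(c,C)=(\wp,\wp')(\beta-\alpha)$. Its left side minus its right side has the form $k_0u_0u_1u_2u_3+k_1(u_1u_2u_3+u_0u_2u_3+u_0u_1u_3+u_0u_1u_2)+k_2(u_0u_2+u_1u_3)+k_3(u_0u_1+u_2u_3)+k_4(u_0u_3+u_1u_2)+k_5(u_0+u_1+u_2+u_3)+k_6$.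 Solving for $u_3$ as a Möbius function of $u_1$ gives the matrix $$U(u_0,u_2;\alpha,\beta)=\frac1D\begin{pmatrix}-k_1u_0u_2-k_3u_0-k_4u_2-k_5&-k_2u_0u_2-k_5(u_0+u_2)-k_6\\ k_0u_0u_2+k_1(u_0+u_2)+k_2&k_1u_0u_2+k_4u_0+k_3u_2+k_5\end{pmatrix},$$ where $D$ is a square root of the determinant of the matrix on the right, so that $\det U=1$ when that determinant is nonzero. Let $\Gamma_0$ be a locally finite graph embedded in an oriented surface (e.g. a planar graph), whose vertices are the black vertices, and whose faces correspond to the white vertices, of a bipartite quad-graph $\Gamma$; the quadrilaterals of $\Gamma$ correspond to the edges of $\Gamma_0$. Let complex parameters be assigned to the edges of $\Gamma$, equal on opposite edges of every quadrilateral. For a vertex $x_0$ of $\Gamma_0$ of valence $n\ge1$ let $(x_0,x_{2j-1},x_{2j},x_{2j+1})$, $j=1,\dots,n$, be the quadrilaterals around it in counterclockwise order, let $\alpha_j$ be the parameter of $x_0x_{2j-1}$ ($\alpha_{n+1}=\alpha_1$), and put $\delta_j=\alpha_j-\alpha_{j+1}$. The discrete Toda equation at $x_0$ is $$\prod_{j=1}^nF(x_0,x_{2j};\alpha_j-\alpha_{j+1})=1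 .\qquad(T)$$ Vertices are identified with the values $x\in\mathbb C$ of the field at them, and $u=\wp(x)$. (1) (Rationality.) For every vertex there is a polynomial $P$ in $n+1$ variables, depending only on $\Lambda$ and the parameters at that vertex, such that for all $x_0,x_2,\dots,x_{2n}\in\mathbb C\setminus\Lambda$ with $x_0\pm x_{2j}-\delta_j\notin\Lambda$ for all $j$, equation (T) holds if and only if $P(u_0,u_2,\dots,u_{2n})=0$. (2) (Zero curvature representation.) Let $x$ be a field on the vertices and $\lambda\in\mathbb C$. Call an edge $(x_0,x_2)$ of $\Gamma_0$ with parameters $\alpha_1,\alpha_2$ and $\delta=\alpha_1-\alpha_2$ regular if $x_0,\,x_2,\,\delta,\,x_0\pm x_2\pm\delta\notin\Lambda$, and call $\lambda$ admissible for it if $2(\alpha_1+\lambda),\,2(\alpha_2+\lambda),\,\alpha_1+\alpha_2+2\lambda\notin\Lambda$. Assign to the crossing of this edge, from $u_1$ to $u_3$, the transition matrix $U(u_0,u_2;\alpha_1+\lambda,\alpha_2+\lambda)$. (a) On a regular edge for which $\lambda$ is admissible, the transition matrix has determinant $1$; it represents the Möbius transformation $u_1\mapsto u_3$ defined by Q4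 with parameters $\alpha_1+\lambda,\alpha_2+\lambda$; and its product with the transition matrix assigned to the same edge seen from $x_2$ is a scalar matrix. (b) At every vertex $x_0$ with $2x_0\notin\Lambda$ all of whose edges are regular, and for every $\lambda$ admissible for these edges, equation (T) holds if and only if the ordered product $$U(u_0,u_{2n};\alpha_n+\lambda,\alpha_1+\lambda)\cdots U(u_0,u_4;\alpha_2+\lambda,\alpha_3+\lambda)\,U(u_0,u_2;\alpha_1+\lambda,\alpha_2+\lambda)$$ is a scalar matrix. (c) Consequently, if the conditions on $x$ in (b) hold at every vertex, then $x$ solves the discrete Toda system (equation (T) at every vertex) if and only if, for every vertex and every $\lambda$ admissible for its edges, the product in (b) is a scalar matrix. -/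

import Mathlib

namespace DiscreteToda

/-- The Weierstrass sigma function of the lattice `Λ` of `L`,
`σ(z) = z ∏_{l ∈ Λ, l ≠ 0} (1 - z / l) exp (z / l + z² / (2 l²))`.
(The factor with `l = 0` is `1`, because division by zero gives `0`; the product is absolutely
convergent.) -/
noncomputable def sigma (L : PeriodPair) (z : ℂ) : ℂ :=
  z * ∏' l : L.lattice, (1 - z / (l : ℂ)) * Complex.exp (z / (l : ℂ) + z ^ 2 / (2 * (l : ℂ) ^ 2))

/-- The leg function `F(x₀, x₁; α)` of the multiplicative three-leg form. -/
noncomputable def F (L : PeriodPair) (x₀ x₁ α : ℂ) : ℂ :=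
  (sigma L (x₀ + x₁ + α) * sigma L (x₀ - x₁ + α)) /
    (sigma L (x₀ + x₁ - α) * sigma L (x₀ - x₁ - α))

/-- The left hand side minus the right hand side of the equation Q4 on a quadrilateral
`(u₀, u₁, u₂, u₃)`, where the edges `u₀u₁`, `u₂u₃` carry `α` and the edges `u₀u₃`, `u₁u₂`
carry `β`. -/
noncomputable def Q4 (L : PeriodPair) (u₀ u₁ u₂ u₃ α β : ℂ) : ℂ :=
  let a := L.weierstrassP α
  let A := L.derivWeierstrassP α
  let b := L.weierstrassP β
  let B := L.derivWeierstrassP β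
  let c := L.weierstrassP (β - α)
  let C := L.derivWeierstrassP (β - α)
  A * ((u₀ - b) * (u₃ - b) - (a - b) * (c - b)) * ((u₁ - b) * (u₂ - b) - (a - b) * (c - b))
    + B * ((u₀ - a) * (u₁ - a) - (b - a) * (c - a)) * ((u₃ - a) * (u₂ - a) - (b - a) * (c - a))
    - A * B * C * (a - b)

/-- The coefficients `k₀, …, k₆` of `Q4` as a multi-affine polynomial in `u₀, …, u₃`;
see `Q4_eq`. -/
noncomputable def k (L : PeriodPair) (α β : ℂ) : Fin 7 → ℂ :=
  let a := L.weierstrassP α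
  let A := L.derivWeierstrassP α
  let b := L.weierstrassP β
  let B := L.derivWeierstrassP β
  let c := L.weierstrassP (β - α)
  let C := L.derivWeierstrassP (β - α)
  let p := b ^ 2 - (a - b) * (c - b)
  let q := a ^ 2 - (b - a) * (c - a)
  ![A + B,
    -(b * A + a * B),
    b ^ 2 * A + a ^ 2 * B,
    b ^ 2 * A + q * B,
    p * A + a ^ 2 * B,
    -(b * p * A + a * q * B),
    p ^ 2 * A + q ^ 2 * B - A * B * C * (a - b)]

/-- The polynomial `Q4` in multi-affine form. -/
theorem Q4_eq (L : PeriodPair) (u₀ u₁ u₂ u₃ α β : ℂ) :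
    Q4 L u₀ u₁ u₂ u₃ α β =
      k L α β 0 * u₀ * u₁ * u₂ * u₃
        + k L α β 1 * (u₁ * u₂ * u₃ + u₀ * u₂ * u₃ + u₀ * u₁ * u₃ + u₀ * u₁ * u₂)
        + k L α β 2 * (u₀ * u₂ + u₁ * u₃)
        + k L α β 3 * (u₀ * u₁ + u₂ * u₃)
        + k L α β 4 * (u₀ * u₃ + u₁ * u₂)
        + k L α β 5 * (u₀ + u₁ + u₂ + u₃)
        + k L α β 6 := by
  simp only [Q4, k, Matrix.cons_val]
  ring

/-- The matrix, before normalization, of the Möbius transformation `u₁ ↦ u₃` defined by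
`Q4 = 0`. -/
noncomputable def rawU (L : PeriodPair) (u₀ u₂ α β : ℂ) : Matrix (Fin 2) (Fin 2) ℂ :=
  let κ := k L α β
  !![-κ 1 * u₀ * u₂ - κ 3 * u₀ - κ 4 * u₂ - κ 5, -κ 2 * u₀ * u₂ - κ 5 * (u₀ + u₂) - κ 6;
     κ 0 * u₀ * u₂ + κ 1 * (u₀ + u₂) + κ 2, κ 1 * u₀ * u₂ + κ 4 * u₀ + κ 3 * u₂ + κ 5]

/-- The transition matrix `U(u₀, u₂; α, β)`: the Möbius matrix divided by a square root of its
determinant (the principal one; the other choice changes the sign of `U`). -/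
noncomputable def U (L : PeriodPair) (u₀ u₂ α β : ℂ) : Matrix (Fin 2) (Fin 2) ℂ :=
  ((rawU L u₀ u₂ α β).det ^ (1 / 2 : ℂ))⁻¹ • rawU L u₀ u₂ α β

/-- A scalar matrix. -/
def IsScalar (M : Matrix (Fin 2) (Fin 2) ℂ) : Prop :=
  ∃ c : ℂ, M = c • (1 : Matrix (Fin 2) (Fin 2) ℂ)

/-- A locally finite graph `Γ₀` with vertex set `V`, embedded in an oriented surface (for
instance a planar graph), described by its set `D` of directed edges. `src d` is the vertex at
which `d` starts, `rev d` is the same edge with the opposite direction, and `rot d` is the next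
directed edge after `d` in the counterclockwise order around `src d`.

The corresponding bipartite quad-graph has the elements of `V` as black vertices and the faces of
`Γ₀` (the cycles of `rot ∘ rev`) as white vertices. Its edges are the corners of the faces of
`Γ₀`; they are identified with `D`, where `d` stands for the corner at `src d` that immediately
precedes the directed edge `d` in the counterclockwise order. Its quadrilateral faces
`(x₀, x₁, x₂, x₃)` correspond to the edges of `Γ₀`: if `d` goes from `x₀` to `x₂`, then the
quad-edges `x₀x₁`, `x₀x₃`, `x₂x₃`, `x₂x₁` are `d`, `rot d`, `rev d`, `rot (rev d)`. -/
structure EmbeddedGraph (V D : Type*) where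
  src : D → V
  rev : D → D
  rot : Equiv.Perm D
  rev_rev : ∀ d, rev (rev d) = d
  rev_ne : ∀ d, rev d ≠ d
  src_eq_iff : ∀ d e, src d = src e ↔ rot.SameCycle d e
  locally_finite : ∀ d, d ∈ Function.periodicPts rot

namespace EmbeddedGraph

variable {V D : Type*} (G : EmbeddedGraph V D)

/-- The end vertex of a directed edge. -/
def tgt (d : D) : V := G.src (G.rev d)

/-- The number `n` of directed edges in the star of the vertex `src d`. -/
noncomputable def valence (d : D) : ℕ := Function.minimalPeriod G.rot d

/-- The directed edges `d, rot d, rot² d, …` of the star of `src d`, counterclockwise. -/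
def star (d : D) (j : ℕ) : D := G.rot^[j] d

/-- An assignment of parameters to the edges of the quad-graph (the corners of `Γ₀`) such that
opposite edges of every quadrilateral carry the same parameter. -/
structure Labelling where
  val : D → ℂ
  val_rev : ∀ d, val (G.rev d) = val d
  val_rot_rev : ∀ d, val (G.rot (G.rev d)) = val (G.rot d)

end EmbeddedGraph

/-- The left hand side `∏ F(x₀, x_{2j}; α_j - α_{j+1})` of the discrete Toda equation on a star
with `n` edges; `y j` is the field at the end of the `j`-th edge. -/
noncomputable def todaProd (L : PeriodPair) (n : ℕ) (α : ℕ → ℂ) (x₀ : ℂ) (y : Fin n → ℂ) : ℂ :=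
  ∏ j : Fin n, F L x₀ (y j) (α j - α (j + 1))

section System

variable {V D : Type*} (L : PeriodPair) (G : EmbeddedGraph V D) (α : G.Labelling)

/-- The discrete Toda equation for the field `x` at the vertex `src d`. -/
def TodaAt (x : V → ℂ) (d : D) : Prop :=
  todaProd L (G.valence d) (fun j => α.val (G.star d j)) (x (G.src d))
    (fun j => x (G.tgt (G.star d j))) = 1

/-- The transition matrix across the edge `d = (u₀, u₂)`, from the white vertex at the corner
`d` to the white vertex at the corner `rot d`, with spectral parameter `lam`. -/
noncomputable def transition (x : V → ℂ) (lam : ℂ) (d : D) : Matrix (Fin 2) (Fin 2) ℂ :=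
  U L (L.weierstrassP (x (G.src d))) (L.weierstrassP (x (G.tgt d)))
    (α.val d + lam) (α.val (G.rot d) + lam)

/-- The product `T_m ⋯ T_2 T_1` of the transition matrices across the first `m` edges of the star
of `src d`, starting with `d`. -/
noncomputable def transitionProd (x : V → ℂ) (lam : ℂ) (d : D) : ℕ → Matrix (Fin 2) (Fin 2) ℂ
  | 0 => 1
  | m + 1 => transition L G α x lam (G.star d m) * transitionProd x lam d m

/-- The monodromy around the vertex `src d`. -/
noncomputable def monodromy (x : V → ℂ) (lam : ℂ) (d : D) : Matrix (Fin 2) (Fin 2) ℂ :=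
  transitionProd L G α x lam d (G.valence d)

/-- Genericity of the field on an edge: the values `u = ℘(x)` at its ends are finite, the
parameter `δ` of the edge is not a period, and neither `F(x₀, x₂; δ)` nor its inverse has a zero
factor. -/
def RegularEdge (x : V → ℂ) (d : D) : Prop :=
  let x₀ := x (G.src d)
  let x₂ := x (G.tgt d)
  let δ := α.val d - α.val (G.rot d)
  x₀ ∉ L.lattice ∧ x₂ ∉ L.lattice ∧ δ ∉ L.lattice ∧
    x₀ + x₂ + δ ∉ L.lattice ∧ x₀ + x₂ - δ ∉ L.lattice ∧
    x₀ - x₂ + δ ∉ L.lattice ∧ x₀ - x₂ - δ ∉ L.lattice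

/-- Genericity of the field on the star of `src d`; the central value is moreover not a branch
point of `℘`. -/
def RegularStar (x : V → ℂ) (d : D) : Prop :=
  2 * x (G.src d) ∉ L.lattice ∧ ∀ e, G.src e = G.src d → RegularEdge L G α x e

/-- Genericity of the spectral parameter on an edge: Q4 with the shifted parameters
`α₁ + lam`, `α₂ + lam` is defined and not degenerate, that is, `A`, `B` are finite and nonzero and
`a ≠ b`. -/
def AdmissibleEdge (lam : ℂ) (d : D) : Prop :=
  2 * (α.val d + lam) ∉ L.lattice ∧ 2 * (α.val (G.rot d) + lam) ∉ L.lattice ∧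
    (α.val d + lam) + (α.val (G.rot d) + lam) ∉ L.lattice

/-- Genericity of the spectral parameter on the star of `src d`. -/
def AdmissibleStar (lam : ℂ) (d : D) : Prop :=
  ∀ e, G.src e = G.src d → AdmissibleEdge L G α lam e

end System

end DiscreteToda

/-!
The theorem rests on the three-leg form of Q4. Write `u₀ = ℘(z)` and `u₂ = ℘(x₂)`. The Möbius
transformation `u₁ ↦ u₃` defined by Q4 maps `℘(z ± α)` to `℘(z ± β)`, so it becomes diagonal in the
coordinates `F(z, x₁; α)` and `F(z, x₃; β)`, which are Möbius functions of `u₁` and `u₃` with these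
zeros and poles. The ratio of the diagonal entries is the long leg `F(z, x₂; α - β)`
(`legMatrix_mul_rawU`, `legFactor_neg`). Around a vertex the coordinates match, because
consecutive edges share a parameter. The monodromy is therefore conjugate to a diagonal matrix
whose two entries differ by the factor `∏ F(x₀, x₂ⱼ; αⱼ - αⱼ₊₁)`, whatever the spectral parameter
is, and it is scalar if and only if the discrete Toda equation holds
(`todaAt_iff_isScalar_monodromy`).

The proof of the three-leg form is an elliptic function argument followed by algebra. The function
`sigma` is entire, odd and quasi-periodic, with simple zeros at the lattice points. Quasi-periodicity
comes from `(log σ)'' = -℘` (`exists_sigma_add_period`). Liouville's theorem gives the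
factorizations of `℘(x) - ℘(y)` (`sigma_add_mul_sigma_sub`) and of a linear function `℘' + m ℘ + n`
(`line_eq_sigma`) into sigma functions. The logarithmic derivative of the first factorization shows
that points of the Weierstrass cubic whose parameters have sum zero are collinear
(`collinear_of_add_eq_zero`); with the differential equation of `℘` this yields the addition
theorem. Once `℘(z + α)`, `℘(z + β)` and `℘(z + β - α)` are eliminated by the addition theorem, the
assertion about Q4 consists of four polynomial identities (`leg_leading_coeff`, `leg_coeff_left`,
`leg_coeff_right`, `leg_constant_coeff`). The addition theorem is used for generic arguments only;
the result extends to all arguments because both sides are continuous and the exceptional set is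
countable.

For the rationality, numerator and denominator of the Toda product are expanded in the `u₂ⱼ`. Their
coefficients are theta functions of `x₀` that are exchanged by `x₀ ↦ -x₀`. Because the parameters
`αⱼ - αⱼ₊₁` have sum zero, the difference of the two becomes an odd elliptic function with poles
only at the lattice points after division by a power of `sigma`. Its product with `℘'` is a
polynomial in `℘` (`IsTheta.exists_polynomial`). The additional zeros of `℘'` do no harm, because
the difference itself vanishes there.
-/

namespace DiscreteToda

open Filter Topology

/-! ### The Weierstrass sigma function -/

section

/-- The factor of the product `sigma` at the lattice point `l`. -/
noncomputable def sigmaFactor (l z : ℂ) : ℂ :=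
  (1 - z / l) * Complex.exp (z / l + z ^ 2 / (2 * l ^ 2))

lemma norm_one_sub_mul_exp_sub_one_le {w : ℂ} (hw : ‖w‖ ≤ 1 / 2) :
    ‖(1 - w) * Complex.exp (w + w ^ 2 / 2) - 1‖ ≤ 2 * ‖w‖ ^ 3 := by
  have hw1 : ‖-w‖ < 1 := by rw [norm_neg]; linarith
  have hne : 1 + -w ≠ 0 := by
    intro h
    have : w = 1 := by linear_combination -h
    rw [this] at hw
    norm_num at hw
  have hlog := Complex.norm_log_sub_logTaylor_le 2 hw1
  have e1 : Complex.log (1 + -w) - Complex.logTaylor (2 + 1) (-w)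
      = Complex.log (1 + -w) + (w + w ^ 2 / 2) := by
    simp [Complex.logTaylor_succ, Complex.logTaylor_zero]
    ring
  rw [e1, norm_neg, ← sub_eq_add_neg] at hlog
  have hinv : (1 - ‖w‖)⁻¹ ≤ 2 := by
    rw [inv_le_comm₀ (by linarith) (by norm_num)]
    linarith
  have h0 : 0 ≤ ‖w‖ := norm_nonneg w
  have hb : ‖Complex.log (1 - w) + (w + w ^ 2 / 2)‖ ≤ ‖w‖ ^ 3 := by
    refine hlog.trans ?_
    norm_num
    nlinarith [pow_nonneg h0 3, mul_le_mul_of_nonneg_left hinv (pow_nonneg h0 3)]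
  have h1 : ‖w‖ ^ 3 ≤ 1 := pow_le_one₀ h0 (by linarith)
  have := Complex.norm_exp_sub_one_le (hb.trans h1)
  rw [Complex.exp_add, Complex.exp_log (by rwa [sub_eq_add_neg])] at this
  exact this.trans (by linarith)

lemma sigmaFactor_zero_left (z : ℂ) : sigmaFactor 0 z = 1 := by simp [sigmaFactor]

lemma sigmaFactor_zero_right (l : ℂ) : sigmaFactor l 0 = 1 := by simp [sigmaFactor]

lemma sigmaFactor_neg (l z : ℂ) : sigmaFactor l (-z) = sigmaFactor (-l) z := by
  simp [sigmaFactor, neg_div, div_neg]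

lemma differentiable_sigmaFactor (l : ℂ) : Differentiable ℂ (sigmaFactor l) := by
  unfold sigmaFactor
  fun_prop

lemma sigmaFactor_ne_zero {l z : ℂ} (h : l ≠ 0 → z ≠ l) : sigmaFactor l z ≠ 0 := by
  by_cases hl : l = 0
  · simp [hl, sigmaFactor_zero_left]
  · refine mul_ne_zero ?_ (Complex.exp_ne_zero _)
    rw [sub_ne_zero]
    intro h'
    exact h hl ((div_eq_one_iff_eq hl).mp h'.symm)

lemma logDeriv_sigmaFactor {l z : ℂ} (hl : l ≠ 0) (h : z ≠ l) :
    logDeriv (sigmaFactor l) z = 1 / (z - l) + 1 / l + z / l ^ 2 := by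
  have hzl : z - l ≠ 0 := sub_ne_zero.mpr h
  have hlz : l - z ≠ 0 := sub_ne_zero.mpr h.symm
  have hd : HasDerivAt (sigmaFactor l)
      ((-(1 / l)) * Complex.exp (z / l + z ^ 2 / (2 * l ^ 2)) + (1 - z / l) *
        (Complex.exp (z / l + z ^ 2 / (2 * l ^ 2)) * (1 / l + (2 * z) / (2 * l ^ 2)))) z := by
    refine HasDerivAt.mul ?_ (HasDerivAt.cexp (HasDerivAt.add ?_ ?_))
    · simpa using ((hasDerivAt_id z).div_const l).const_sub 1
    · exact (hasDerivAt_id z).div_const l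
    · simpa using (hasDerivAt_pow 2 z).div_const (2 * l ^ 2)
  rw [logDeriv_apply, hd.deriv, sigmaFactor]
  have := Complex.exp_ne_zero (z / l + z ^ 2 / (2 * l ^ 2))
  have h1 : 1 - z / l ≠ 0 := by
    rw [one_sub_div hl]
    exact div_ne_zero hlz hl
  field_simp
  ring

variable (L : PeriodPair)

lemma countable_lattice : (L.lattice : Set ℂ).Countable := by
  have : Countable L.lattice := L.latticeEquivProd.toEquiv.countable_iff.mpr inferInstance
  exact Set.countable_coe_iff.mp this

/-- The product defining `sigma`, without the factor `z`. -/
noncomputable def sigmaProd (z : ℂ) : ℂ := ∏' l : L.lattice, sigmaFactor l z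

lemma sigma_eq_mul_sigmaProd (z : ℂ) : sigma L z = z * sigmaProd L z := rfl

lemma norm_sigmaFactor_sub_one_le {r : ℝ} {z l : ℂ} (hz : ‖z‖ < r) (hl : 2 * r ≤ ‖l‖) :
    ‖sigmaFactor l z - 1‖ ≤ 2 * r ^ 3 * ‖l‖ ^ (-3 : ℝ) := by
  have h0 : 0 ≤ ‖z‖ := norm_nonneg z
  have hl0 : 0 < ‖l‖ := by linarith
  have hw : ‖z / l‖ ≤ 1 / 2 := by
    rw [norm_div, div_le_div_iff₀ hl0 (by norm_num)]
    linarith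
  have h := norm_one_sub_mul_exp_sub_one_le hw
  have e : (z / l) ^ 2 / 2 = z ^ 2 / (2 * l ^ 2) := by
    rw [div_pow, div_div, mul_comm]
  rw [e] at h
  refine h.trans ?_
  rw [norm_div, div_pow, Real.rpow_neg hl0.le, ← div_eq_mul_inv, mul_div_assoc]
  norm_cast
  gcongr

lemma hasProdLocallyUniformlyOn_sigmaFactor (r : ℝ) :
    HasProdLocallyUniformlyOn (fun (l : L.lattice) z ↦ sigmaFactor l z) (sigmaProd L)
      (Metric.ball 0 r) := by
  have h := Summable.hasProdLocallyUniformlyOn_one_add (K := Metric.ball (0 : ℂ) r)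
    (f := fun (l : L.lattice) z ↦ sigmaFactor l z - 1)
    (u := fun l : L.lattice ↦ 2 * r ^ 3 * ‖(l : ℂ)‖ ^ (-3 : ℝ)) Metric.isOpen_ball
    ((ZLattice.summable_norm_rpow _ _ (by simp; norm_num)).mul_left _) ?_ ?_
  · simp only [add_sub_cancel] at h
    exact h
  · have hfin : {l : L.lattice | ¬ 2 * r ≤ ‖(l : ℂ)‖}.Finite := by
      refine (isCompact_iff_finite.mp (isCompact_closedBall (0 : L.lattice) (2 * r))).subset ?_
      intro l hl
      simp only [Set.mem_ofPred_eq, not_le] at hl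
      simpa using hl.le
    filter_upwards [hfin.compl_mem_cofinite] with l hl z hz
    simp only [Set.mem_compl_iff, Set.mem_ofPred_eq, not_not] at hl
    exact norm_sigmaFactor_sub_one_le (by simpa using hz) hl
  · intro l
    exact ((differentiable_sigmaFactor l).sub_const 1).continuous.continuousOn

lemma tendstoLocallyUniformlyOn_sigmaProd (r : ℝ) :
    TendstoLocallyUniformlyOn
      (fun (s : Finset L.lattice) z ↦ ∏ l ∈ s, sigmaFactor l z) (sigmaProd L) atTop
      (Metric.ball 0 r) :=
  hasProdLocallyUniformlyOn_iff_tendstoLocallyUniformlyOn.mp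
    (hasProdLocallyUniformlyOn_sigmaFactor L r)

lemma differentiable_prod_sigmaFactor (s : Finset L.lattice) :
    Differentiable ℂ (fun z ↦ ∏ l ∈ s, sigmaFactor (l : ℂ) z) :=
  Differentiable.fun_finsetProd fun l _ ↦ differentiable_sigmaFactor l

lemma mem_ball_norm_add_one (z : ℂ) : z ∈ Metric.ball (0 : ℂ) (‖z‖ + 1) := by simp

lemma differentiable_sigmaProd : Differentiable ℂ (sigmaProd L) := by
  intro z
  have h := (tendstoLocallyUniformlyOn_sigmaProd L (‖z‖ + 1)).differentiableOn
    (.of_forall fun s ↦ (differentiable_prod_sigmaFactor L s).differentiableOn) Metric.isOpen_ball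
  exact h.differentiableAt (Metric.isOpen_ball.mem_nhds (mem_ball_norm_add_one z))

lemma sigmaProd_ne_zero {z : ℂ} (hz : z ∈ L.lattice → z = 0) : sigmaProd L z ≠ 0 := by
  have h := tprod_one_add_ne_zero_of_summable
    (f := fun l : L.lattice ↦ sigmaFactor (l : ℂ) z - 1) ?_ ?_
  · simpa [sigmaProd] using h
  · intro l
    rw [add_sub_cancel]
    refine sigmaFactor_ne_zero fun hl h ↦ hl ?_
    rw [← h]
    exact hz (h ▸ l.2)
  · refine Summable.of_norm_bounded_eventually (g := fun l : L.lattice ↦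
      2 * (‖z‖ + 1) ^ 3 * ‖(l : ℂ)‖ ^ (-3 : ℝ))
      ((ZLattice.summable_norm_rpow _ _ (by simp; norm_num)).mul_left _) ?_
    have hfin : {l : L.lattice | ¬ 2 * (‖z‖ + 1) ≤ ‖(l : ℂ)‖}.Finite := by
      refine (isCompact_iff_finite.mp
        (isCompact_closedBall (0 : L.lattice) (2 * (‖z‖ + 1)))).subset ?_
      intro l hl
      simp only [Set.mem_ofPred_eq, not_le] at hl
      simpa using hl.le
    filter_upwards [hfin.compl_mem_cofinite] with l hl
    simp only [Set.mem_compl_iff, Set.mem_ofPred_eq, not_not] at hl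
    rw [norm_norm]
    exact norm_sigmaFactor_sub_one_le (by simp) hl

lemma sigmaProd_eq_zero {z : ℂ} (hz : z ∈ L.lattice) (h0 : z ≠ 0) : sigmaProd L z = 0 := by
  refine tprod_of_exists_eq_zero ⟨⟨z, hz⟩, ?_⟩
  simp [sigmaFactor, div_self h0]

lemma differentiable_sigma : Differentiable ℂ (sigma L) :=
  differentiable_id.mul (differentiable_sigmaProd L)

lemma sigma_eq_zero_iff {z : ℂ} : sigma L z = 0 ↔ z ∈ L.lattice := by
  rw [sigma_eq_mul_sigmaProd, mul_eq_zero]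
  constructor
  · rintro (rfl | h)
    · exact zero_mem _
    · by_contra hz
      exact sigmaProd_ne_zero L (fun h' ↦ absurd h' hz) h
  · intro hz
    by_cases h0 : z = 0
    · exact .inl h0
    · exact .inr (sigmaProd_eq_zero L hz h0)

lemma sigma_zero : sigma L 0 = 0 := (sigma_eq_zero_iff L).mpr (zero_mem _)

lemma sigma_ne_zero {z : ℂ} (hz : z ∉ L.lattice) : sigma L z ≠ 0 :=
  fun h ↦ hz ((sigma_eq_zero_iff L).mp h)

lemma sigma_neg (z : ℂ) : sigma L (-z) = -sigma L z := by
  rw [sigma_eq_mul_sigmaProd, sigma_eq_mul_sigmaProd, neg_mul, neg_inj]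
  congr 1
  rw [sigmaProd, sigmaProd, ← (Equiv.neg L.lattice).tprod_eq]
  congr with l
  simp [sigmaFactor_neg]

lemma deriv_sigma_zero : deriv (sigma L) 0 = 1 := by
  have h : HasDerivAt (sigma L) (1 * sigmaProd L 0 + 0 * deriv (sigmaProd L) 0) 0 :=
    (hasDerivAt_id (0 : ℂ)).mul (differentiable_sigmaProd L 0).hasDerivAt
  rw [h.deriv]
  simp [sigmaProd, sigmaFactor_zero_right]

/-- The second logarithmic derivative of `sigmaProd`. The partial products converge together with
their first two derivatives, so the second logarithmic derivative is the termwise limit; no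
convergence of the series of first logarithmic derivatives is needed. -/
lemma deriv_logDeriv_sigmaProd {z : ℂ} (hz : z ∉ L.lattice) :
    deriv (logDeriv (sigmaProd L)) z = -(L.weierstrassP z - 1 / z ^ 2) := by
  set P : Finset L.lattice → ℂ → ℂ := fun s z ↦ ∏ l ∈ s, sigmaFactor (l : ℂ) z with hP
  have hz0 : z ≠ 0 := fun h ↦ hz (h ▸ zero_mem _)
  have hzl : ∀ l : L.lattice, z ≠ l := fun l h ↦ hz (h ▸ l.2)
  have hmem := mem_ball_norm_add_one z
  have T0 := tendstoLocallyUniformlyOn_sigmaProd L (‖z‖ + 1)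
  have T1 := T0.deriv (.of_forall fun s ↦ (differentiable_prod_sigmaFactor L s).differentiableOn)
    Metric.isOpen_ball
  have T2 := T1.deriv (.of_forall fun s ↦
    ((differentiable_prod_sigmaFactor L s).deriv).differentiableOn) Metric.isOpen_ball
  have t0 := T0.tendsto_at hmem
  have t1 := T1.tendsto_at hmem
  have t2 := T2.tendsto_at hmem
  have hne := sigmaProd_ne_zero L (fun h ↦ absurd h hz)
  have second : ∀ f : ℂ → ℂ, Differentiable ℂ f → f z ≠ 0 →
      deriv (logDeriv f) z = (deriv (deriv f) z * f z - deriv f z * deriv f z) / f z ^ 2 := by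
    intro f hf h
    exact (hf.deriv z).hasDerivAt.div (hf z).hasDerivAt h |>.deriv
  have lim : Tendsto (fun s ↦ deriv (logDeriv (P s)) z) atTop
      (𝓝 (deriv (logDeriv (sigmaProd L)) z)) := by
    rw [second _ (differentiable_sigmaProd L) hne]
    refine Tendsto.congr (fun s ↦ ?_)
      (((t2.mul t0).sub (t1.mul t1)).div (t0.pow 2) (pow_ne_zero 2 hne))
    rw [second (P s) (differentiable_prod_sigmaFactor L s)
      (Finset.prod_ne_zero_iff.mpr fun l _ ↦ sigmaFactor_ne_zero fun _ ↦ hzl l)]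
    rfl
  refine tendsto_nhds_unique lim ?_
  have hs := (L.hasSum_weierstrassPExcept 0 z).neg
  have hdef := L.weierstrassPExcept_def 0 z
  rw [ZeroMemClass.coe_zero] at hdef
  rw [hdef] at hs
  have hs' : HasSum (fun l : L.lattice ↦ -(if (l : ℂ) = 0 then 0 else
      1 / (z - l) ^ 2 - 1 / (l : ℂ) ^ 2)) (-(L.weierstrassP z - 1 / z ^ 2)) := by
    convert! hs using 1
    simp
    ring
  refine Tendsto.congr (fun s ↦ ?_) hs'
  have hev : logDeriv (P s) =ᶠ[𝓝 z] fun w ↦ ∑ l ∈ s,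
      (if (l : ℂ) = 0 then 0 else 1 / (w - l) + 1 / (l : ℂ) + w / (l : ℂ) ^ 2) := by
    filter_upwards [L.isClosed_lattice.isOpen_compl.mem_nhds hz] with w hw
    have hwl : ∀ l : L.lattice, w ≠ l := fun l h ↦ hw (h ▸ l.2)
    rw [hP]
    rw [logDeriv_prod (fun l _ ↦ sigmaFactor_ne_zero fun _ ↦ hwl l)
      (fun l _ ↦ differentiable_sigmaFactor l w)]
    refine Finset.sum_congr rfl fun l _ ↦ ?_
    split_ifs with h
    · rw [h, show sigmaFactor 0 = fun _ ↦ (1 : ℂ) from funext sigmaFactor_zero_left]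
      simp [logDeriv_apply]
    · exact logDeriv_sigmaFactor h (hwl l)
  rw [hev.deriv_eq]
  refine (HasDerivAt.fun_sum fun l _ ↦ ?_).deriv.symm
  split_ifs with h
  · simpa using hasDerivAt_const z (0 : ℂ)
  · have hzl' : z - l ≠ 0 := sub_ne_zero.mpr (hzl l)
    have d1 : HasDerivAt (fun w : ℂ ↦ 1 / (w - l)) (-1 / (z - l) ^ 2) z := by
      simpa [Pi.inv_def] using ((hasDerivAt_id z).sub_const (l : ℂ)).inv hzl'
    have d2 := (d1.add_const (1 / (l : ℂ))).add ((hasDerivAt_id z).div_const ((l : ℂ) ^ 2))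
    exact d2.congr_deriv (by ring)

lemma hasDerivAt_logDeriv_sigma {z : ℂ} (hz : z ∉ L.lattice) :
    HasDerivAt (logDeriv (sigma L)) (-L.weierstrassP z) z := by
  have hd : DifferentiableAt ℂ (logDeriv (sigmaProd L)) z :=
    ((differentiable_sigmaProd L).deriv z).div (differentiable_sigmaProd L z)
      (sigmaProd_ne_zero L fun h ↦ absurd h hz)
  have h1 := hd.hasDerivAt
  rw [deriv_logDeriv_sigmaProd L hz] at h1
  have hz0 : z ≠ 0 := fun h ↦ hz (h ▸ zero_mem _)
  have h2 : HasDerivAt (fun w : ℂ ↦ w⁻¹ + logDeriv (sigmaProd L) w) (-L.weierstrassP z) z := by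
    refine ((hasDerivAt_inv hz0).add h1).congr_deriv ?_
    field_simp
    ring
  refine h2.congr_of_eventuallyEq ?_
  filter_upwards [L.isClosed_lattice.isOpen_compl.mem_nhds hz] with w hw
  have hw0 : w ≠ 0 := fun h ↦ hw (h ▸ zero_mem _)
  have : sigma L = fun w ↦ id w * sigmaProd L w := rfl
  rw [this, logDeriv_mul w hw0 (sigmaProd_ne_zero L fun h ↦ absurd h hw) differentiableAt_id
    (differentiable_sigmaProd L w), logDeriv_id, one_div]

lemma isPreconnected_compl_lattice : IsPreconnected (L.lattice : Set ℂ)ᶜ :=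
  ((countable_lattice L).isPathConnected_compl_of_one_lt_rank
    (by rw [Complex.rank_real_complex]; norm_num)).isConnected.isPreconnected

/-- Quasi-periodicity of `sigma`: the logarithmic derivative changes by a constant under a
translation by a period, because its derivative `-℘` is periodic. -/
lemma exists_sigma_add_period (ω : ℂ) (hω : ω ∈ L.lattice) :
    ∃ c η : ℂ, c ≠ 0 ∧ ∀ z, sigma L (z + ω) = c * Complex.exp (η * z) * sigma L z := by
  have hopen := L.isClosed_lattice.isOpen_compl
  have hadd : ∀ {z}, z ∉ L.lattice → z + ω ∉ L.lattice := fun hz h ↦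
    hz ((L.lattice.add_mem_iff_left hω).mp h)
  have hper : ∀ z, L.weierstrassP (z + ω) = L.weierstrassP z :=
    fun z ↦ L.weierstrassP_add_coe z ⟨ω, hω⟩
  have hd1 : ∀ z ∉ L.lattice, HasDerivAt
      (fun z ↦ logDeriv (sigma L) (z + ω) - logDeriv (sigma L) z) 0 z := by
    intro z hz
    have := ((hasDerivAt_logDeriv_sigma L (hadd hz)).comp_add_const z ω).sub
      (hasDerivAt_logDeriv_sigma L hz)
    rwa [hper, sub_self] at this
  obtain ⟨η, hη⟩ := hopen.exists_is_const_of_deriv_eq_zero (isPreconnected_compl_lattice L)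
    (fun z hz ↦ (hd1 z hz).differentiableAt.differentiableWithinAt)
    (fun z hz ↦ (hd1 z hz).deriv)
  have hσd : ∀ z, HasDerivAt (sigma L) (deriv (sigma L) z) z :=
    fun z ↦ (differentiable_sigma L z).hasDerivAt
  have hd2 : ∀ z ∉ L.lattice, HasDerivAt
      (fun z ↦ sigma L (z + ω) * Complex.exp (-(η * z)) / sigma L z) 0 z := by
    intro z hz
    have h0 := sigma_ne_zero L hz
    have h1 := sigma_ne_zero L (hadd hz)
    have hη' := hη z hz
    simp only [logDeriv_apply] at hη'
    have he : HasDerivAt (fun z ↦ Complex.exp (-(η * z))) (Complex.exp (-(η * z)) * -η) z := by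
      simpa using (((hasDerivAt_id z).const_mul η).neg).cexp
    refine ((((hσd (z + ω)).comp_add_const z ω).mul he).div (hσd z) h0).congr_deriv ?_
    rw [div_eq_zero_iff]
    left
    have hη'' : deriv (sigma L) (z + ω) * sigma L z - deriv (sigma L) z * sigma L (z + ω)
        = η * sigma L z * sigma L (z + ω) := by
      rw [← hη']
      field_simp
    simp only [Pi.mul_apply]
    linear_combination Complex.exp (-(η * z)) * hη''
  obtain ⟨c, hc⟩ := hopen.exists_is_const_of_deriv_eq_zero (isPreconnected_compl_lattice L)
    (fun z hz ↦ (hd2 z hz).differentiableAt.differentiableWithinAt)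
    (fun z hz ↦ (hd2 z hz).deriv)
  have key : ∀ z ∉ L.lattice, sigma L (z + ω) = c * Complex.exp (η * z) * sigma L z := by
    intro z hz
    have h0 := sigma_ne_zero L hz
    have := hc z hz
    rw [div_eq_iff h0] at this
    have he : Complex.exp (-(η * z)) * Complex.exp (η * z) = 1 := by
      rw [← Complex.exp_add, neg_add_cancel, Complex.exp_zero]
    linear_combination Complex.exp (η * z) * this - sigma L (z + ω) * he
  refine ⟨c, η, ?_, fun z ↦ ?_⟩
  · rintro rfl
    have := key _ L.ω₁_div_two_notMem_lattice
    rw [zero_mul, zero_mul] at this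
    exact sigma_ne_zero L (hadd L.ω₁_div_two_notMem_lattice) this
  · by_cases hz : z ∈ L.lattice
    · rw [(sigma_eq_zero_iff L).mpr hz, (sigma_eq_zero_iff L).mpr (add_mem hz hω), mul_zero]
    · exact key z hz

end

/-! ### Theta functions and Liouville's theorem -/

section

/-- Two functions that are continuous at a point and agree off a countable set agree there. -/
lemma eq_of_forall_notMem_countable {f g : ℂ → ℂ} {S : Set ℂ} (hS : S.Countable) {z : ℂ}
    (hf : ContinuousAt f z) (hg : ContinuousAt g z) (h : ∀ w ∉ S, f w = g w) : f z = g z := by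
  have hd : Dense Sᶜ := hS.dense_compl ℝ
  have hne : (𝓝[Sᶜ] z).NeBot := mem_closure_iff_nhdsWithin_neBot.mp (hd z)
  refine tendsto_nhds_unique (hf.tendsto.mono_left nhdsWithin_le_nhds) ?_ (l := 𝓝[Sᶜ] z)
  refine (hg.tendsto.mono_left nhdsWithin_le_nhds).congr' ?_
  filter_upwards [self_mem_nhdsWithin] with w hw
  exact (h w hw).symm

/-- All zeros of `f` are simple. -/
def SimpleZeros (f : ℂ → ℂ) : Prop := ∀ z, f z = 0 → deriv f z ≠ 0

lemma SimpleZeros.eventually_ne {f : ℂ → ℂ} (hf : Differentiable ℂ f) (h : SimpleZeros f) (z : ℂ) :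
    ∀ᶠ w in 𝓝[≠] z, f w ≠ 0 := by
  by_cases hz : f z = 0
  · exact (hf z).hasDerivAt.eventually_ne (h z hz)
  · exact ((hf z).continuousAt.eventually_ne hz).filter_mono nhdsWithin_le_nhds

lemma SimpleZeros.mul {f g : ℂ → ℂ} (hf : Differentiable ℂ f) (hg : Differentiable ℂ g)
    (h : SimpleZeros f) (h' : SimpleZeros g) (hfg : ∀ z, f z = 0 → g z ≠ 0) :
    SimpleZeros (fun z ↦ f z * g z) := by
  intro z hz
  rw [deriv_fun_mul (hf z) (hg z)]
  rcases mul_eq_zero.mp hz with h0 | h0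
  · rw [h0, zero_mul, add_zero]
    exact mul_ne_zero (h z h0) (hfg z h0)
  · rw [h0, mul_zero, zero_add]
    exact mul_ne_zero (fun h1 ↦ hfg z h1 h0) (h' z h0)

lemma SimpleZeros.cancel {f g h : ℂ → ℂ} (hh : Differentiable ℂ h) (hs : SimpleZeros h)
    (hf : Continuous f) (hg : Continuous g) (e : ∀ z, f z * h z = g z * h z) (z : ℂ) :
    f z = g z := by
  refine tendsto_nhds_unique (hf.continuousAt.tendsto.mono_left nhdsWithin_le_nhds)
    (l := 𝓝[≠] z) ?_
  refine (hg.continuousAt.tendsto.mono_left nhdsWithin_le_nhds).congr' ?_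
  filter_upwards [hs.eventually_ne hh z] with w hw
  exact (mul_right_cancel₀ hw (e w)).symm

/-- An entire function that vanishes at the zeros of an entire function with simple zeros is a
multiple of it. -/
lemma SimpleZeros.exists_eq_mul {f g : ℂ → ℂ} (hf : Differentiable ℂ f) (hg : Differentiable ℂ g)
    (hs : SimpleZeros g) (h : ∀ z, g z = 0 → f z = 0) :
    ∃ q : ℂ → ℂ, Differentiable ℂ q ∧ ∀ z, f z = q z * g z := by
  classical
  refine ⟨fun z ↦ if g z = 0 then deriv f z / deriv g z else f z / g z, fun z₀ ↦ ?_, fun z ↦ ?_⟩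
  · by_cases hz : g z₀ = 0
    · have hfd : DifferentiableAt ℂ (dslope f z₀) z₀ :=
        ((Complex.differentiableOn_dslope univ_mem).mpr hf.differentiableOn).differentiableAt
          univ_mem
      have hgd : DifferentiableAt ℂ (dslope g z₀) z₀ :=
        ((Complex.differentiableOn_dslope univ_mem).mpr hg.differentiableOn).differentiableAt
          univ_mem
      have h0 : dslope g z₀ z₀ ≠ 0 := by
        rw [dslope_same]
        exact hs z₀ hz
      refine (hfd.div hgd h0).congr_of_eventuallyEq ?_
      have hev := hs.eventually_ne hg z₀
      rw [eventually_nhdsWithin_iff] at hev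
      filter_upwards [hev] with w hw
      by_cases hwz : w = z₀
      · subst hwz
        simp [hz]
      · rw [if_neg (hw hwz)]
        simp only [Pi.div_apply]
        rw [dslope_of_ne _ hwz, dslope_of_ne _ hwz, slope_def_field, slope_def_field, hz, h z₀ hz,
          sub_zero, sub_zero, div_div_div_cancel_right₀ (sub_ne_zero.mpr hwz)]
    · refine ((hf z₀).div (hg z₀) hz).congr_of_eventuallyEq ?_
      filter_upwards [(hg z₀).continuousAt.eventually_ne hz] with w hw
      simp [hw]
  · by_cases hz : g z = 0
    · rw [hz, mul_zero, h z hz]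
    · simp [hz]

variable (L : PeriodPair)

/-- The constant factor `c` in `σ(z + ω) = c exp (η z) σ(z)`. -/
noncomputable def quasiConst (ω : L.lattice) : ℂ := (exists_sigma_add_period L ω ω.2).choose

/-- The exponent `η` in `σ(z + ω) = c exp (η z) σ(z)`. -/
noncomputable def quasiExp (ω : L.lattice) : ℂ :=
  (exists_sigma_add_period L ω ω.2).choose_spec.choose

lemma quasiConst_ne_zero (ω : L.lattice) : quasiConst L ω ≠ 0 :=
  (exists_sigma_add_period L ω ω.2).choose_spec.choose_spec.1

lemma sigma_add_coe (z : ℂ) (ω : L.lattice) :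
    sigma L (z + ω) = quasiConst L ω * Complex.exp (quasiExp L ω * z) * sigma L z :=
  (exists_sigma_add_period L ω ω.2).choose_spec.choose_spec.2 z

/-- A theta function of weight `m` and characteristic `s`: an entire function with the
multipliers of `z ↦ σ(z + s₁) ⋯ σ(z + sₘ)`, where `s = s₁ + ⋯ + sₘ`. -/
structure IsTheta (m : ℕ) (s : ℂ) (f : ℂ → ℂ) : Prop where
  differentiable : Differentiable ℂ f
  add_coe : ∀ (z : ℂ) (ω : L.lattice), f (z + ω) =
    (quasiConst L ω * Complex.exp (quasiExp L ω * z)) ^ m * Complex.exp (quasiExp L ω * s) * f z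

variable {L}

lemma isTheta_sigma_add (a : ℂ) : IsTheta L 1 a (fun z ↦ sigma L (z + a)) where
  differentiable := (differentiable_sigma L).comp (differentiable_id.add_const a)
  add_coe z ω := by
    rw [add_right_comm, sigma_add_coe, mul_add, Complex.exp_add]
    ring

lemma isTheta_sigma : IsTheta L 1 0 (sigma L) := by
  simpa using isTheta_sigma_add (L := L) 0

lemma isTheta_one : IsTheta L 0 0 (fun _ ↦ 1) where
  differentiable := differentiable_const 1
  add_coe z ω := by simp

namespace IsTheta

variable {m m' : ℕ} {s s' : ℂ} {f g : ℂ → ℂ}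

lemma mul (hf : IsTheta L m s f) (hg : IsTheta L m' s' g) :
    IsTheta L (m + m') (s + s') (fun z ↦ f z * g z) where
  differentiable := hf.differentiable.mul hg.differentiable
  add_coe z ω := by
    rw [hf.add_coe, hg.add_coe, mul_add, Complex.exp_add]
    ring

lemma pow (hf : IsTheta L m s f) (n : ℕ) : IsTheta L (n * m) (n * s) (fun z ↦ f z ^ n) := by
  induction n with
  | zero => simpa using isTheta_one (L := L)
  | succ n ih =>
    have := ih.mul hf
    simp only [← pow_succ] at this
    convert! this using 1
    · ring
    · push_cast; ring

lemma const_mul (c : ℂ) (hf : IsTheta L m s f) : IsTheta L m s (fun z ↦ c * f z) where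
  differentiable := hf.differentiable.const_mul c
  add_coe z ω := by
    rw [hf.add_coe]
    ring

lemma add (hf : IsTheta L m s f) (hg : IsTheta L m s g) : IsTheta L m s (fun z ↦ f z + g z) where
  differentiable := hf.differentiable.add hg.differentiable
  add_coe z ω := by
    rw [hf.add_coe, hg.add_coe]
    ring

lemma sub (hf : IsTheta L m s f) (hg : IsTheta L m s g) : IsTheta L m s (fun z ↦ f z - g z) where
  differentiable := hf.differentiable.sub hg.differentiable
  add_coe z ω := by
    rw [hf.add_coe, hg.add_coe]
    ring

lemma comp_add (hf : IsTheta L m s f) (a : ℂ) :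
    IsTheta L m (s + m * a) (fun z ↦ f (z + a)) where
  differentiable := hf.differentiable.comp (differentiable_id.add_const a)
  add_coe z ω := by
    have : Complex.exp (quasiExp L ω * (m * a)) = Complex.exp (quasiExp L ω * a) ^ m := by
      rw [← Complex.exp_nat_mul]
      congr 1
      ring
    rw [add_right_comm, hf.add_coe, mul_add, mul_add, Complex.exp_add, Complex.exp_add, this]
    ring

lemma prod {ι : Type*} (S : Finset ι) {m : ℕ} {s : ι → ℂ} {f : ι → ℂ → ℂ}
    (hf : ∀ i ∈ S, IsTheta L m (s i) (f i)) :
    IsTheta L (S.card * m) (∑ i ∈ S, s i) (fun z ↦ ∏ i ∈ S, f i z) := by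
  classical
  induction S using Finset.induction_on with
  | empty => simpa using isTheta_one (L := L)
  | insert i S hi ih =>
    have := (hf i (Finset.mem_insert_self i S)).mul
      (ih fun j hj ↦ hf j (Finset.mem_insert_of_mem hj))
    simp only [Finset.prod_insert hi, Finset.sum_insert hi, Finset.card_insert_of_notMem hi]
    convert! this using 1
    ring

lemma continuous (hf : IsTheta L m s f) : Continuous f := hf.differentiable.continuous

/-- The set of zeros of a theta function is invariant under the lattice. -/
lemma eq_zero_of_sub_mem (hf : IsTheta L m s f) {z w : ℂ} (h : z - w ∈ L.lattice)
    (hw : f w = 0) : f z = 0 := by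
  have := hf.add_coe w ⟨z - w, h⟩
  rw [hw, mul_zero, add_sub_cancel] at this
  exact this

/-- Liouville's theorem for elliptic functions. -/
lemma eq_const (hf : IsTheta L 0 0 f) (z : ℂ) : f z = f 0 :=
  hf.differentiable.apply_eq_apply_of_bounded
    (IsZLattice.isCompact_range_of_periodic L.lattice f hf.continuous
      fun z w hw ↦ by simpa using hf.add_coe z ⟨w, hw⟩).isBounded z 0

/-- The quotient of two theta functions is a theta function if the denominator has simple zeros,
all of which are zeros of the numerator. -/
lemma exists_eq_mul (hf : IsTheta L (m + m') (s + s') f) (hg : IsTheta L m' s' g)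
    (hs : SimpleZeros g) (h : ∀ z, g z = 0 → f z = 0) :
    ∃ q, IsTheta L m s q ∧ ∀ z, f z = q z * g z := by
  obtain ⟨q, hq, e⟩ := hs.exists_eq_mul hf.differentiable hg.differentiable h
  refine ⟨q, ⟨hq, fun z ω ↦ ?_⟩, e⟩
  refine hs.cancel hg.differentiable (f := fun z ↦ q (z + ω)) (g := fun z ↦
    (quasiConst L ω * Complex.exp (quasiExp L ω * z)) ^ m * Complex.exp (quasiExp L ω * s) * q z)
    (hq.continuous.comp (by fun_prop)) (by have := hq.continuous; fun_prop) (fun z ↦ ?_) z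
  have h1 := hf.add_coe z ω
  rw [e, e z, hg.add_coe, mul_add, Complex.exp_add] at h1
  have hne : (quasiConst L ω * Complex.exp (quasiExp L ω * z)) ^ m' *
      Complex.exp (quasiExp L ω * s') ≠ 0 :=
    mul_ne_zero (pow_ne_zero _ (mul_ne_zero (quasiConst_ne_zero L ω) (Complex.exp_ne_zero _)))
      (Complex.exp_ne_zero _)
  refine mul_left_cancel₀ hne ?_
  linear_combination h1

lemma exists_eq_const_mul (hf : IsTheta L m s f) (hg : IsTheta L m s g)
    (hs : SimpleZeros g) (h : ∀ z, g z = 0 → f z = 0) : ∃ C, ∀ z, f z = C * g z := by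
  obtain ⟨q, hq, e⟩ := exists_eq_mul (m := 0) (s := 0) (by simpa using hf) hg hs h
  exact ⟨q 0, fun z ↦ by rw [e, hq.eq_const]⟩

end IsTheta

lemma deriv_sigma_ne_zero {l : ℂ} (hl : l ∈ L.lattice) : deriv (sigma L) l ≠ 0 := by
  have h : (fun z ↦ sigma L (z + l)) =
      fun z ↦ (quasiConst L ⟨l, hl⟩ * Complex.exp (quasiExp L ⟨l, hl⟩ * z)) * sigma L z :=
    funext fun z ↦ sigma_add_coe L z ⟨l, hl⟩
  have h1 := congrArg (fun f ↦ deriv f 0) h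
  rw [deriv_comp_add_const, zero_add, deriv_fun_mul (by fun_prop) (differentiable_sigma L 0),
    sigma_zero, deriv_sigma_zero, mul_zero, mul_zero, zero_add, Complex.exp_zero, mul_one,
    mul_one] at h1
  rw [h1]
  exact quasiConst_ne_zero L _

lemma simpleZeros_sigma_add (a : ℂ) : SimpleZeros (fun z ↦ sigma L (z + a)) := by
  intro z hz
  rw [deriv_comp_add_const]
  exact deriv_sigma_ne_zero ((sigma_eq_zero_iff L).mp hz)

lemma simpleZeros_sigma : SimpleZeros (sigma L) := by
  simpa using simpleZeros_sigma_add (L := L) 0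

variable (L)

open Classical in
/-- The entire function that continues `σ² ℘`. -/
noncomputable def sigmaSqP (z : ℂ) : ℂ :=
  if z ∈ L.lattice then deriv (sigma L) z ^ 2 else sigma L z ^ 2 * L.weierstrassP z

lemma sigmaSqP_of_notMem {z : ℂ} (hz : z ∉ L.lattice) :
    sigmaSqP L z = sigma L z ^ 2 * L.weierstrassP z := if_neg hz

lemma sigmaSqP_of_mem {z : ℂ} (hz : z ∈ L.lattice) :
    sigmaSqP L z = deriv (sigma L) z ^ 2 := if_pos hz

lemma sigmaSqP_zero : sigmaSqP L 0 = 1 := by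
  rw [sigmaSqP_of_mem L (zero_mem _), deriv_sigma_zero, one_pow]

lemma sigmaSqP_neg (z : ℂ) : sigmaSqP L (-z) = sigmaSqP L z := by
  by_cases hz : z ∈ L.lattice
  · have h : (fun z ↦ sigma L (-z)) = fun z ↦ -sigma L z := funext (sigma_neg L)
    have h1 := congrArg (fun f ↦ deriv f z) h
    simp only [deriv_comp_neg, deriv.fun_neg, neg_inj] at h1
    rw [sigmaSqP_of_mem L hz, sigmaSqP_of_mem L (neg_mem hz), h1]
  · rw [sigmaSqP_of_notMem L hz, sigmaSqP_of_notMem L (neg_mem_iff.not.mpr hz), sigma_neg, neg_sq,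
      L.weierstrassP_neg]

lemma differentiableAt_weierstrassP {z : ℂ} (hz : z ∉ L.lattice) :
    DifferentiableAt ℂ L.weierstrassP z :=
  L.differentiableOn_weierstrassP.differentiableAt (L.isClosed_lattice.isOpen_compl.mem_nhds hz)

lemma hasDerivAt_weierstrassP {z : ℂ} (hz : z ∉ L.lattice) :
    HasDerivAt L.weierstrassP (L.derivWeierstrassP z) z := by
  have := (differentiableAt_weierstrassP L hz).hasDerivAt
  rwa [L.deriv_weierstrassP] at this

lemma differentiable_sigmaSqP : Differentiable ℂ (sigmaSqP L) := by
  intro z₀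
  by_cases hz : z₀ ∈ L.lattice
  · have hd : DifferentiableAt ℂ (dslope (sigma L) z₀) z₀ :=
      ((Complex.differentiableOn_dslope univ_mem).mpr
        (differentiable_sigma L).differentiableOn).differentiableAt univ_mem
    have hnhds := L.compl_lattice_sdiff_singleton_mem_nhds z₀
    have he : DifferentiableAt ℂ (L.weierstrassPExcept z₀) z₀ :=
      (L.differentiableOn_weierstrassPExcept z₀).differentiableAt hnhds
    have h : DifferentiableAt ℂ (fun z ↦ dslope (sigma L) z₀ z ^ 2 +
        sigma L z ^ 2 * (L.weierstrassPExcept z₀ z - 1 / z₀ ^ 2)) z₀ :=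
      (hd.pow 2).add (((differentiable_sigma L z₀).pow 2).mul (he.sub_const _))
    refine h.congr_of_eventuallyEq ?_
    filter_upwards [hnhds] with w hw
    by_cases hwz : w = z₀
    · subst hwz
      rw [sigmaSqP_of_mem L hz, dslope_same, (sigma_eq_zero_iff L).mpr hz]
      ring
    · have hwL : w ∉ L.lattice := fun h ↦ hw ⟨h, hwz⟩
      have hsub : w - z₀ ≠ 0 := sub_ne_zero.mpr hwz
      rw [sigmaSqP_of_notMem L hwL, dslope_of_ne _ hwz, slope_def_field,
        (sigma_eq_zero_iff L).mpr hz, sub_zero, ← L.weierstrassPExcept_add ⟨z₀, hz⟩]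
      field_simp
      ring
  · refine (((differentiable_sigma L z₀).pow 2).mul
      (differentiableAt_weierstrassP L hz)).congr_of_eventuallyEq ?_
    filter_upwards [L.isClosed_lattice.isOpen_compl.mem_nhds hz] with w hw
    exact sigmaSqP_of_notMem L hw

variable {L} in
lemma add_coe_notMem {z : ℂ} (hz : z ∉ L.lattice) (ω : L.lattice) : z + ω ∉ L.lattice :=
  fun h ↦ hz ((L.lattice.add_mem_iff_left ω.2).mp h)

lemma isTheta_sigmaSqP : IsTheta L 2 0 (sigmaSqP L) where
  differentiable := differentiable_sigmaSqP L
  add_coe z ω := by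
    have hc := (differentiable_sigmaSqP L).continuous
    refine eq_of_forall_notMem_countable (countable_lattice L) (f := fun z ↦ sigmaSqP L (z + ω))
      (g := fun z ↦ (quasiConst L ω * Complex.exp (quasiExp L ω * z)) ^ 2 *
        Complex.exp (quasiExp L ω * 0) * sigmaSqP L z) (by fun_prop) (by fun_prop) fun w hw ↦ ?_
    rw [sigmaSqP_of_notMem L hw, sigmaSqP_of_notMem L (add_coe_notMem hw ω), sigma_add_coe,
      L.weierstrassP_add_coe]
    simp
    ring

/-- The entire function that continues `σ³ ℘'`. -/
noncomputable def sigmaCubeP' (z : ℂ) : ℂ :=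
  sigma L z * deriv (sigmaSqP L) z - 2 * deriv (sigma L) z * sigmaSqP L z

lemma sigmaCubeP'_zero : sigmaCubeP' L 0 = -2 := by
  simp [sigmaCubeP', sigma_zero, deriv_sigma_zero, sigmaSqP_zero]

lemma sigmaCubeP'_of_notMem {z : ℂ} (hz : z ∉ L.lattice) :
    sigmaCubeP' L z = sigma L z ^ 3 * L.derivWeierstrassP z := by
  have h : HasDerivAt (sigmaSqP L) (2 * sigma L z * deriv (sigma L) z * L.weierstrassP z +
      sigma L z ^ 2 * L.derivWeierstrassP z) z := by
    have h1 := ((differentiable_sigma L z).hasDerivAt.pow 2).mul (hasDerivAt_weierstrassP L hz)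
    refine (h1.congr_of_eventuallyEq ?_).congr_deriv (by simp)
    filter_upwards [L.isClosed_lattice.isOpen_compl.mem_nhds hz] with w hw
    exact sigmaSqP_of_notMem L hw
  rw [sigmaCubeP', h.deriv, sigmaSqP_of_notMem L hz]
  ring

lemma differentiable_sigmaCubeP' : Differentiable ℂ (sigmaCubeP' L) := by
  have h1 := differentiable_sigma L
  have h2 := differentiable_sigmaSqP L
  have h3 := h1.deriv
  have h4 := h2.deriv
  unfold sigmaCubeP'
  fun_prop

lemma isTheta_sigmaCubeP' : IsTheta L 3 0 (sigmaCubeP' L) where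
  differentiable := differentiable_sigmaCubeP' L
  add_coe z ω := by
    have hc := (differentiable_sigmaCubeP' L).continuous
    refine eq_of_forall_notMem_countable (countable_lattice L)
      (f := fun z ↦ sigmaCubeP' L (z + ω))
      (g := fun z ↦ (quasiConst L ω * Complex.exp (quasiExp L ω * z)) ^ 3 *
        Complex.exp (quasiExp L ω * 0) * sigmaCubeP' L z) (by fun_prop) (by fun_prop) fun w hw ↦ ?_
    rw [sigmaCubeP'_of_notMem L hw, sigmaCubeP'_of_notMem L (add_coe_notMem hw ω), sigma_add_coe,
      L.derivWeierstrassP_add_coe]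
    simp
    ring

lemma sigmaCubeP'_neg (z : ℂ) : sigmaCubeP' L (-z) = sigmaCubeP' L z := by
  have hc := (differentiable_sigmaCubeP' L).continuous
  refine eq_of_forall_notMem_countable (countable_lattice L)
      (f := fun z ↦ sigmaCubeP' L (-z)) (by fun_prop) (by fun_prop) fun w hw ↦ ?_
  rw [sigmaCubeP'_of_notMem L hw, sigmaCubeP'_of_notMem L (neg_mem_iff.not.mpr hw), sigma_neg,
    L.derivWeierstrassP_neg]
  ring

end

/-! ### Addition formulas -/

section

variable (L : PeriodPair)

lemma continuousAt_weierstrassP {z : ℂ} (hz : z ∉ L.lattice) : ContinuousAt L.weierstrassP z :=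
  (differentiableAt_weierstrassP L hz).continuousAt

lemma continuousAt_derivWeierstrassP {z : ℂ} (hz : z ∉ L.lattice) :
    ContinuousAt L.derivWeierstrassP z :=
  (L.differentiableOn_derivWeierstrassP.differentiableAt
    (L.isClosed_lattice.isOpen_compl.mem_nhds hz)).continuousAt

/-- The set of all `w` with `n w + s ∈ Λ`, where `n` is a nonzero integer, is countable. -/
lemma countable_setOf_mul_add_mem (s : ℂ) {n : ℂ} (hn : n ≠ 0) :
    {w : ℂ | n * w + s ∈ L.lattice}.Countable :=
  (countable_lattice L).preimage fun a b h ↦ by simpa [hn] using h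

lemma weierstrassP_eq_of_sub_mem {z w : ℂ} (h : z - w ∈ L.lattice) :
    L.weierstrassP z = L.weierstrassP w := by
  have := L.weierstrassP_add_coe w ⟨z - w, h⟩
  rwa [add_sub_cancel] at this

lemma derivWeierstrassP_eq_of_sub_mem {z w : ℂ} (h : z - w ∈ L.lattice) :
    L.derivWeierstrassP z = L.derivWeierstrassP w := by
  have := L.derivWeierstrassP_add_coe w ⟨z - w, h⟩
  rwa [add_sub_cancel] at this

/-- The addition formula of `sigma` in the generic case: both sides are theta functions of `x` of
weight `2` with the zeros `±y`, which are simple and distinct modulo the lattice. -/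
lemma sigma_add_mul_sigma_sub_aux {y : ℂ} (hy : 2 * y ∉ L.lattice) (x : ℂ) :
    sigma L (x + y) * sigma L (x - y) =
      sigma L y ^ 2 * (sigma L x ^ 2 * L.weierstrassP y - sigmaSqP L x) := by
  have hy1 : y ∉ L.lattice := fun h ↦ hy (by rw [two_mul]; exact add_mem h h)
  have hf : IsTheta L 2 0 (fun x ↦ L.weierstrassP y * sigma L x ^ 2 - sigmaSqP L x) := by
    have := (((isTheta_sigma (L := L)).pow 2).const_mul (L.weierstrassP y)).sub
      (by simpa using isTheta_sigmaSqP L)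
    simpa using this
  have hg : IsTheta L 2 0 (fun x ↦ sigma L (x + y) * sigma L (x + -y)) := by
    simpa using (isTheta_sigma_add (L := L) y).mul (isTheta_sigma_add (-y))
  have hs : SimpleZeros (fun x ↦ sigma L (x + y) * sigma L (x + -y)) := by
    refine (simpleZeros_sigma_add y).mul (isTheta_sigma_add (L := L) y).differentiable
      (isTheta_sigma_add (L := L) (-y)).differentiable (simpleZeros_sigma_add (-y)) fun x h h' ↦ ?_
    rw [sigma_eq_zero_iff] at h h'
    apply hy
    convert! sub_mem h h' using 1
    ring
  obtain ⟨C, hC⟩ := hf.exists_eq_const_mul hg hs fun x hx ↦ by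
    have key : ∀ w : ℂ, w ∉ L.lattice → L.weierstrassP w = L.weierstrassP y →
        L.weierstrassP y * sigma L w ^ 2 - sigmaSqP L w = 0 := by
      intro w hw h
      rw [sigmaSqP_of_notMem L hw, h]
      ring
    rcases mul_eq_zero.mp hx with h | h <;> rw [sigma_eq_zero_iff] at h
    · refine key x (fun hx ↦ hy1 ((L.lattice.add_mem_iff_right hx).mp h)) ?_
      rw [weierstrassP_eq_of_sub_mem L (z := x) (w := -y) (by simpa using h), L.weierstrassP_neg]
    · refine key x (fun hx ↦ hy1 (neg_mem_iff.mp ((L.lattice.add_mem_iff_right hx).mp h))) ?_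
      exact weierstrassP_eq_of_sub_mem L (by rwa [sub_eq_add_neg])
  have hy0 := sigma_ne_zero L hy1
  have h0 := hC 0
  rw [sigma_zero, sigmaSqP_zero, zero_add, zero_add, sigma_neg] at h0
  have hx := hC x
  rw [← sub_eq_add_neg] at hx
  have hC1 : C * sigma L y ^ 2 = 1 := by linear_combination h0
  linear_combination (-sigma L y ^ 2) * hx - (sigma L (x + y) * sigma L (x - y)) * hC1

/-- The addition formula of `sigma`. -/
lemma sigma_add_mul_sigma_sub {y : ℂ} (hy : y ∉ L.lattice) (x : ℂ) :
    sigma L (x + y) * sigma L (x - y) =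
      sigma L y ^ 2 * (sigma L x ^ 2 * L.weierstrassP y - sigmaSqP L x) := by
  have hc := (differentiable_sigma L).continuous
  have hp := continuousAt_weierstrassP L hy
  refine eq_of_forall_notMem_countable (countable_setOf_mul_add_mem L 0 two_ne_zero) (z := y)
    (f := fun y ↦ sigma L (x + y) * sigma L (x - y))
    (g := fun y ↦ sigma L y ^ 2 * (sigma L x ^ 2 * L.weierstrassP y - sigmaSqP L x))
    (by fun_prop) (by fun_prop) fun w hw ↦ ?_
  exact sigma_add_mul_sigma_sub_aux L (by simpa using hw) x

lemma sigma_add_mul_sigma_sub' {x y : ℂ} (hx : x ∉ L.lattice) (hy : y ∉ L.lattice) :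
    sigma L (x + y) * sigma L (x - y) =
      sigma L x ^ 2 * sigma L y ^ 2 * (L.weierstrassP y - L.weierstrassP x) := by
  rw [sigma_add_mul_sigma_sub L hy, sigmaSqP_of_notMem L hx]
  ring

lemma weierstrassP_sub_eq {x y : ℂ} (hx : x ∉ L.lattice) (hy : y ∉ L.lattice) :
    L.weierstrassP x - L.weierstrassP y =
      -(sigma L (x + y) * sigma L (x - y)) / (sigma L x ^ 2 * sigma L y ^ 2) := by
  have := sigma_ne_zero L hx
  have := sigma_ne_zero L hy
  rw [sigma_add_mul_sigma_sub' L hx hy]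
  field_simp
  ring

lemma weierstrassP_ne {x y : ℂ} (hx : x ∉ L.lattice) (hy : y ∉ L.lattice)
    (h1 : x + y ∉ L.lattice) (h2 : x - y ∉ L.lattice) :
    L.weierstrassP x - L.weierstrassP y ≠ 0 := by
  rw [weierstrassP_sub_eq L hx hy]
  exact div_ne_zero (neg_ne_zero.mpr (mul_ne_zero (sigma_ne_zero L h1) (sigma_ne_zero L h2)))
    (mul_ne_zero (pow_ne_zero 2 (sigma_ne_zero L hx)) (pow_ne_zero 2 (sigma_ne_zero L hy)))

/-- The derivative of `℘` in terms of `sigma`; this is the addition formula of `sigma`,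
differentiated on the diagonal. -/
lemma derivWeierstrassP_eq {z : ℂ} (hz : z ∉ L.lattice) :
    L.derivWeierstrassP z = -sigma L (2 * z) / sigma L z ^ 4 := by
  have hd := (differentiable_sigma L)
  have h : HasDerivAt (fun x ↦ sigma L x ^ 2 * sigma L z ^ 2 *
      (L.weierstrassP z - L.weierstrassP x))
      (sigma L z ^ 2 * sigma L z ^ 2 * (-L.derivWeierstrassP z)) z := by
    have h1 := (((hd z).hasDerivAt.pow 2).mul_const (sigma L z ^ 2)).mul
      ((hasDerivAt_weierstrassP L hz).const_sub (L.weierstrassP z))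
    exact h1.congr_deriv (by simp)
  have h' : HasDerivAt (fun x ↦ sigma L (x + z) * sigma L (x - z)) (sigma L (z + z)) z := by
    have h1 := ((hd (z + z)).hasDerivAt.comp_add_const z z).mul
      ((hd (z - z)).hasDerivAt.comp_sub_const z z)
    exact h1.congr_deriv (by simp [sigma_zero, deriv_sigma_zero])
  have he : (fun x ↦ sigma L (x + z) * sigma L (x - z)) =ᶠ[𝓝 z] fun x ↦
      sigma L x ^ 2 * sigma L z ^ 2 * (L.weierstrassP z - L.weierstrassP x) := by
    filter_upwards [L.isClosed_lattice.isOpen_compl.mem_nhds hz] with x hx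
    exact sigma_add_mul_sigma_sub' L hx hz
  have key := (h'.congr_of_eventuallyEq he.symm).unique h
  have := sigma_ne_zero L hz
  rw [two_mul, key]
  field_simp

lemma derivWeierstrassP_ne_zero {z : ℂ} (hz : 2 * z ∉ L.lattice) : L.derivWeierstrassP z ≠ 0 := by
  have hz1 : z ∉ L.lattice := fun h ↦ hz (by rw [two_mul]; exact add_mem h h)
  rw [derivWeierstrassP_eq L hz1]
  exact div_ne_zero (neg_ne_zero.mpr (sigma_ne_zero L hz)) (pow_ne_zero 4 (sigma_ne_zero L hz1))

lemma logDeriv_sigma_neg (z : ℂ) : logDeriv (sigma L) (-z) = -logDeriv (sigma L) z := by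
  have h : (fun z ↦ sigma L (-z)) = fun z ↦ -sigma L z := funext (sigma_neg L)
  have h1 := congrArg (fun f ↦ deriv f z) h
  simp only [deriv_comp_neg, deriv.fun_neg, neg_inj] at h1
  rw [logDeriv_apply, logDeriv_apply, h1, sigma_neg, div_neg]

/-- The logarithmic derivative of the addition formula of `sigma`. -/
lemma derivWeierstrassP_div_sub {x y : ℂ} (hx : x ∉ L.lattice) (hy : y ∉ L.lattice)
    (h1 : x + y ∉ L.lattice) (h2 : x - y ∉ L.lattice) :
    L.derivWeierstrassP x / (L.weierstrassP x - L.weierstrassP y) =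
      logDeriv (sigma L) (x + y) + logDeriv (sigma L) (x - y) - 2 * logDeriv (sigma L) x := by
  have hd := differentiable_sigma L
  have s0 := sigma_ne_zero L hx
  have s1 := sigma_ne_zero L h1
  have s2 := sigma_ne_zero L h2
  have sy := sigma_ne_zero L hy
  have hne := weierstrassP_ne L hx hy h1 h2
  have hne' : L.weierstrassP y - L.weierstrassP x ≠ 0 := by rwa [← neg_sub, neg_ne_zero]
  have h : HasDerivAt (fun x ↦ sigma L x ^ 2 * sigma L y ^ 2 *
      (L.weierstrassP y - L.weierstrassP x))
      (2 * sigma L x * deriv (sigma L) x * sigma L y ^ 2 * (L.weierstrassP y - L.weierstrassP x) +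
        sigma L x ^ 2 * sigma L y ^ 2 * (-L.derivWeierstrassP x)) x := by
    have h1 := (((hd x).hasDerivAt.pow 2).mul_const (sigma L y ^ 2)).mul
      ((hasDerivAt_weierstrassP L hx).const_sub (L.weierstrassP y))
    exact h1.congr_deriv (by simp)
  have h' : HasDerivAt (fun x ↦ sigma L (x + y) * sigma L (x - y))
      (deriv (sigma L) (x + y) * sigma L (x - y) + sigma L (x + y) * deriv (sigma L) (x - y)) x :=
    ((hd (x + y)).hasDerivAt.comp_add_const x y).mul ((hd (x - y)).hasDerivAt.comp_sub_const x y)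
  have he : (fun x ↦ sigma L (x + y) * sigma L (x - y)) =ᶠ[𝓝 x] fun x ↦
      sigma L x ^ 2 * sigma L y ^ 2 * (L.weierstrassP y - L.weierstrassP x) := by
    filter_upwards [L.isClosed_lattice.isOpen_compl.mem_nhds hx] with x hx
    exact sigma_add_mul_sigma_sub' L hx hy
  have key := (h'.congr_of_eventuallyEq he.symm).unique h
  have e := sigma_add_mul_sigma_sub' L hx hy
  have lhs : logDeriv (sigma L) (x + y) + logDeriv (sigma L) (x - y) =
      (deriv (sigma L) (x + y) * sigma L (x - y) + sigma L (x + y) * deriv (sigma L) (x - y)) /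
        (sigma L (x + y) * sigma L (x - y)) := by
    rw [logDeriv_apply, logDeriv_apply]
    field_simp
  rw [lhs, key, e, logDeriv_apply]
  field_simp
  ring

lemma slope_eq_logDeriv {x y : ℂ} (hx : x ∉ L.lattice) (hy : y ∉ L.lattice)
    (h1 : x + y ∉ L.lattice) (h2 : x - y ∉ L.lattice) :
    (L.derivWeierstrassP x - L.derivWeierstrassP y) / (L.weierstrassP x - L.weierstrassP y) =
      2 * (logDeriv (sigma L) (x + y) - logDeriv (sigma L) x - logDeriv (sigma L) y) := by
  have e1 := derivWeierstrassP_div_sub L hx hy h1 h2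
  have e2 := derivWeierstrassP_div_sub L hy hx (by rwa [add_comm])
    (by rwa [← neg_sub, neg_mem_iff])
  rw [← neg_sub x y, logDeriv_sigma_neg, ← neg_sub (L.weierstrassP x), div_neg, add_comm y x] at e2
  rw [sub_div]
  linear_combination e1 + e2

/-- The points with parameters `x`, `y`, `w` on the Weierstrass cubic are collinear if
`x + y + w = 0`. -/
lemma collinear_of_add_eq_zero {x y w : ℂ} (hx : x ∉ L.lattice) (hy : y ∉ L.lattice)
    (hw : w ∉ L.lattice) (hxy : x - y ∉ L.lattice) (hxw : x - w ∉ L.lattice)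
    (h0 : x + y + w = 0) :
    (L.derivWeierstrassP x - L.derivWeierstrassP y) * (L.weierstrassP x - L.weierstrassP w) =
      (L.derivWeierstrassP x - L.derivWeierstrassP w) *
        (L.weierstrassP x - L.weierstrassP y) := by
  have exy : x + y = -w := by linear_combination h0
  have exw : x + w = -y := by linear_combination h0
  have n1 : x + y ∉ L.lattice := by rwa [exy, neg_mem_iff]
  have n2 : x + w ∉ L.lattice := by rwa [exw, neg_mem_iff]
  rw [← div_eq_div_iff (weierstrassP_ne L hx hy n1 hxy) (weierstrassP_ne L hx hw n2 hxw),
    slope_eq_logDeriv L hx hy n1 hxy, slope_eq_logDeriv L hx hw n2 hxw, exy, exw,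
    logDeriv_sigma_neg, logDeriv_sigma_neg]
  ring

/-- The sum of the abscissas of three collinear points on the Weierstrass cubic. -/
lemma weierstrassP_add_add {x y w : ℂ} (hx : x ∉ L.lattice) (hy : y ∉ L.lattice)
    (hw : w ∉ L.lattice) (hxy : x - y ∉ L.lattice) (hxw : x - w ∉ L.lattice)
    (hyw : y - w ∉ L.lattice) (h0 : x + y + w = 0) :
    4 * (L.weierstrassP x + L.weierstrassP y + L.weierstrassP w) *
        (L.weierstrassP x - L.weierstrassP y) ^ 2 =
      (L.derivWeierstrassP x - L.derivWeierstrassP y) ^ 2 := by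
  have exy : x + y = -w := by linear_combination h0
  have exw : x + w = -y := by linear_combination h0
  have eyw : y + w = -x := by linear_combination h0
  have d1 := weierstrassP_ne L hx hy (by rwa [exy, neg_mem_iff]) hxy
  have d2 := weierstrassP_ne L hx hw (by rwa [exw, neg_mem_iff]) hxw
  have d3 := weierstrassP_ne L hy hw (by rwa [eyw, neg_mem_iff]) hyw
  have hl := collinear_of_add_eq_zero L hx hy hw hxy hxw h0
  have qx := L.derivWeierstrassP_sq x hx
  have qy := L.derivWeierstrassP_sq y hy
  have qw := L.derivWeierstrassP_sq w hw
  revert d1 d2 d3 hl qx qy qw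
  generalize L.weierstrassP x = X
  generalize L.weierstrassP y = Y
  generalize L.weierstrassP w = W
  generalize L.derivWeierstrassP x = X'
  generalize L.derivWeierstrassP y = Y'
  generalize L.derivWeierstrassP w = W'
  intro d1 d2 d3 hl qx qy qw
  obtain ⟨m, hm⟩ : ∃ m, m * (X - Y) = X' - Y' := ⟨(X' - Y') / (X - Y), div_mul_cancel₀ _ d1⟩
  have hm2 : m * (X - W) = X' - W' := by
    refine mul_right_cancel₀ d1 ?_
    linear_combination (X - W) * hm + hl
  -- Divided differences of the cubic equation along the line.
  have a1 : m * (X' + Y') = 4 * (X ^ 2 + X * Y + Y ^ 2) - L.g₂ := by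
    refine mul_right_cancel₀ d1 ?_
    linear_combination (X' + Y') * hm + qx - qy
  have a2 : m * (X' + W') = 4 * (X ^ 2 + X * W + W ^ 2) - L.g₂ := by
    refine mul_right_cancel₀ d2 ?_
    linear_combination (X' + W') * hm2 + qx - qw
  have a3 : m ^ 2 = 4 * (X + Y + W) := by
    refine mul_right_cancel₀ d3 ?_
    linear_combination m * (hm2 - hm) + a1 - a2
  rw [← hm, ← a3]
  ring

end

/-! ### The three-leg form of Q4 for generic parameters -/

section

section Algebra

/-! In the following identities `(a, A)`, `(b, -B)`, `(c, C)` are the points of the line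
`y = m x + n` on the Weierstrass cubic, `u` is the abscissa of a further point `(u, u')`, and
`g = (u' + m u + n) / (u - b)`. The equation of the cubic becomes the relation `h`, and `P` is the
abscissa of the sum of `(u, u')` and `(b, B)`. The `k`'s are the coefficients of Q4; its
coefficients with respect to `u₁` and `u₂` at `u₀ = u`, `u₃ = P` are computed modulo `h`. -/

variable {a b c m n u g P A B : ℂ}

lemma leg_leading_coeff (hA : A = m * a + n) (hB : B = -(m * b + n)) (hm : a = m ^ 2 / 4 - b - c)
    (h : g * (g * (u - b) - 2 * (m * u + n)) = 4 * (u - a) * (u - c))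
    (hP : P = (g - m) ^ 2 / 4 - u - b) {k₀ k₁ k₄ : ℂ} (e₀ : k₀ = A + B)
    (e₁ : k₁ = -(b * A + a * B)) (e₄ : k₄ = (b ^ 2 - (a - b) * (c - b)) * A + a ^ 2 * B) :
    k₁ * u + k₄ + P * (k₀ * u + k₁) = -(a - b) * B / 4 * g ^ 2 := by
  subst e₀ e₁ e₄ hP hB hA
  rw [hm] at h ⊢
  linear_combination (m * (m ^ 2 / 4 - 2 * b - c) / 4) * h

lemma leg_coeff_left (hA : A = m * a + n) (hB : B = -(m * b + n)) (hm : a = m ^ 2 / 4 - b - c)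
    (h : g * (g * (u - b) - 2 * (m * u + n)) = 4 * (u - a) * (u - c))
    (hP : P = (g - m) ^ 2 / 4 - u - b) {k₁ k₂ k₃ k₅ : ℂ}
    (e₁ : k₁ = -(b * A + a * B)) (e₂ : k₂ = b ^ 2 * A + a ^ 2 * B)
    (e₃ : k₃ = b ^ 2 * A + (a ^ 2 - (b - a) * (c - a)) * B)
    (e₅ : k₅ = -(b * (b ^ 2 - (a - b) * (c - b)) * A + a * (a ^ 2 - (b - a) * (c - a)) * B)) :
    16 * (k₃ * u + k₅ + P * (k₁ * u + k₂)) =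
      (a - b) * B * ((4 * (u - a) + m * g) ^ 2 - 4 * (u + c) * g ^ 2) := by
  subst e₁ e₂ e₃ e₅ hP hB hA
  rw [hm] at h ⊢
  linear_combination (-4 * b * (m * (m ^ 2 / 4 - 2 * b - c))) * h

lemma leg_coeff_right (hA : A = m * a + n) (hB : B = -(m * b + n)) (hm : a = m ^ 2 / 4 - b - c)
    (h : g * (g * (u - b) - 2 * (m * u + n)) = 4 * (u - a) * (u - c))
    (hP : P = (g - m) ^ 2 / 4 - u - b) {k₁ k₂ k₃ k₅ : ℂ}
    (e₁ : k₁ = -(b * A + a * B)) (e₂ : k₂ = b ^ 2 * A + a ^ 2 * B)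
    (e₃ : k₃ = b ^ 2 * A + (a ^ 2 - (b - a) * (c - a)) * B)
    (e₅ : k₅ = -(b * (b ^ 2 - (a - b) * (c - b)) * A + a * (a ^ 2 - (b - a) * (c - a)) * B)) :
    16 * (k₂ * u + k₅ + P * (k₁ * u + k₃)) =
      (a - b) * B * ((4 * (u - c) + m * g) ^ 2 - 4 * (u + a) * g ^ 2) := by
  subst e₁ e₂ e₃ e₅ hP hB hA
  rw [hm] at h ⊢
  linear_combination (-4 * b * (m * (m ^ 2 / 4 - 2 * b - c))) * h

lemma leg_constant_coeff {C : ℂ} (hA : A = m * a + n) (hB : B = -(m * b + n)) (hC : C = m * c + n)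
    (hm : a = m ^ 2 / 4 - b - c)
    (h : g * (g * (u - b) - 2 * (m * u + n)) = 4 * (u - a) * (u - c))
    (hP : P = (g - m) ^ 2 / 4 - u - b) {p q k₄ k₅ k₆ : ℂ}
    (hp : p = b ^ 2 - (a - b) * (c - b)) (hq : q = a ^ 2 - (b - a) * (c - a))
    (e₄ : k₄ = p * A + a ^ 2 * B) (e₅ : k₅ = -(b * p * A + a * q * B))
    (e₆ : k₆ = p ^ 2 * A + q ^ 2 * B - A * B * C * (a - b)) :
    64 * g ^ 2 * (k₅ * u + k₆ + P * (k₄ * u + k₅)) =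
      -(a - b) * B * ((4 * (u - c) + m * g) ^ 2 - 4 * (u + a) * g ^ 2) *
        ((4 * (u - a) + m * g) ^ 2 - 4 * (u + c) * g ^ 2) := by
  subst hp hq e₄ e₅ e₆ hP hB hA hC
  rw [hm] at h ⊢
  set a := m ^ 2 / 4 - b - c with ha
  linear_combination (16 * g ^ 2 * ((b ^ 2 - (a - b) * (c - b)) * (m * a + n) +
    -(m * b + n) * (a ^ 2 + (a - b) * (2 * (u - b) - a - c))) - (a - b) * -(m * b + n) *
      (16 * (4 * (u - a) * (u - c) + g * (g * (u - b) - 2 * (m * u + n))) +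
        32 * m * g * (2 * u - a - c))) * h

end Algebra

variable (L : PeriodPair)

/-- The line through three points of the Weierstrass cubic with parameters `α`, `-β`, `β - α`. -/
lemma exists_line {α β : ℂ} (hα : α ∉ L.lattice) (hβ : β ∉ L.lattice) (hγ : β - α ∉ L.lattice)
    (h1 : α + β ∉ L.lattice) (h2 : 2 * α - β ∉ L.lattice) (h3 : 2 * β - α ∉ L.lattice) :
    ∃ m n : ℂ, L.derivWeierstrassP α = m * L.weierstrassP α + n ∧
      L.derivWeierstrassP β = -(m * L.weierstrassP β + n) ∧
      L.derivWeierstrassP (β - α) = m * L.weierstrassP (β - α) + n ∧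
      L.weierstrassP α = m ^ 2 / 4 - L.weierstrassP β - L.weierstrassP (β - α) := by
  have g1 : α - -β ∉ L.lattice := by rwa [sub_neg_eq_add]
  have g2 : α - (β - α) ∉ L.lattice := by convert! h2 using 2; ring
  have g3 : -β - (β - α) ∉ L.lattice := by
    rw [← neg_mem_iff]; convert! h3 using 2; ring
  have gβ : -β ∉ L.lattice := by rwa [neg_mem_iff]
  have hl := collinear_of_add_eq_zero L hα gβ hγ g1 g2 (by ring)
  have hs := weierstrassP_add_add L hα gβ hγ g1 g2 g3 (by ring)
  rw [L.weierstrassP_neg, L.derivWeierstrassP_neg] at hl hs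
  have hne := weierstrassP_ne L hα hβ h1 (by rwa [← neg_sub, neg_mem_iff])
  obtain ⟨m, hm⟩ : ∃ m, m * (L.weierstrassP α - L.weierstrassP β) =
      L.derivWeierstrassP α + L.derivWeierstrassP β := ⟨_, div_mul_cancel₀ _ hne⟩
  refine ⟨m, L.derivWeierstrassP α - m * L.weierstrassP α, by ring, ?_, ?_, ?_⟩
  · linear_combination -hm
  · refine mul_right_cancel₀ hne ?_
    linear_combination (L.weierstrassP α - L.weierstrassP (β - α)) * hm + hl
  · refine mul_right_cancel₀ (pow_ne_zero 2 hne) ?_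
    linear_combination hs / 4 -
      (m * (L.weierstrassP α - L.weierstrassP β) +
        (L.derivWeierstrassP α + L.derivWeierstrassP β)) / 4 * hm

/-- The factorization of a linear function on the Weierstrass cubic: it has the simple zeros
`-α`, `β`, `α - β` and a triple pole at the lattice points. -/
lemma line_eq_sigma {α β m n : ℂ} (hα : α ∉ L.lattice) (hβ : β ∉ L.lattice)
    (hγ : β - α ∉ L.lattice) (h1 : α + β ∉ L.lattice) (h2 : 2 * α - β ∉ L.lattice)
    (h3 : 2 * β - α ∉ L.lattice) (hA : L.derivWeierstrassP α = m * L.weierstrassP α + n)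
    (hB : L.derivWeierstrassP β = -(m * L.weierstrassP β + n))
    (hC : L.derivWeierstrassP (β - α) = m * L.weierstrassP (β - α) + n) {z : ℂ}
    (hz : z ∉ L.lattice) :
    (L.derivWeierstrassP z + m * L.weierstrassP z + n) * sigma L z ^ 3 *
        (sigma L α * sigma L β * sigma L (β - α)) =
      2 * (sigma L (z - β) * sigma L (z + α) * sigma L (z + (β - α))) := by
  have hf : IsTheta L 3 0 (fun z ↦ sigmaCubeP' L z + m * (sigma L z * sigmaSqP L z) +
      n * sigma L z ^ 3) := by
    have t1 : IsTheta L 3 0 (fun z ↦ sigma L z * sigmaSqP L z) := by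
      simpa using (isTheta_sigma (L := L)).mul (isTheta_sigmaSqP L)
    have t2 : IsTheta L 3 0 (fun z ↦ sigma L z ^ 3) := by
      simpa using (isTheta_sigma (L := L)).pow 3
    exact ((isTheta_sigmaCubeP' L).add (t1.const_mul m)).add (t2.const_mul n)
  have hg : IsTheta L 3 0
      (fun z ↦ sigma L (z + -β) * sigma L (z + α) * sigma L (z + (β - α))) := by
    simpa using ((isTheta_sigma_add (L := L) (-β)).mul (isTheta_sigma_add α)).mul
      (isTheta_sigma_add (β - α))
  have hs : SimpleZeros
      (fun z ↦ sigma L (z + -β) * sigma L (z + α) * sigma L (z + (β - α))) := by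
    refine SimpleZeros.mul ((isTheta_sigma_add (L := L) (-β)).mul
      (isTheta_sigma_add α)).differentiable (isTheta_sigma_add (L := L) _).differentiable
      ((simpleZeros_sigma_add _).mul (isTheta_sigma_add (L := L) _).differentiable
        (isTheta_sigma_add (L := L) _).differentiable (simpleZeros_sigma_add _)
        fun x h h' ↦ ?_) (simpleZeros_sigma_add _) fun x h h' ↦ ?_
    · rw [sigma_eq_zero_iff] at h h'
      apply h1
      convert! sub_mem h' h using 1
      ring
    · rw [sigma_eq_zero_iff] at h'
      rcases mul_eq_zero.mp h with h | h <;> rw [sigma_eq_zero_iff] at h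
      · apply h3
        convert! sub_mem h' h using 1
        ring
      · apply h2
        convert! sub_mem h h' using 1
        ring
  obtain ⟨K, hK⟩ := hf.exists_eq_const_mul hg hs fun x hx ↦ by
    have key : ∀ w : ℂ, w ∉ L.lattice → ∀ v, w - v ∈ L.lattice →
        L.derivWeierstrassP v + m * L.weierstrassP v + n = 0 →
        sigmaCubeP' L w + m * (sigma L w * sigmaSqP L w) + n * sigma L w ^ 3 = 0 := by
      intro w hw v hv h
      rw [sigmaSqP_of_notMem L hw, sigmaCubeP'_of_notMem L hw, weierstrassP_eq_of_sub_mem L hv,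
        derivWeierstrassP_eq_of_sub_mem L hv]
      linear_combination sigma L w ^ 3 * h
    rcases mul_eq_zero.mp hx with h | h
    · rcases mul_eq_zero.mp h with h | h <;> rw [sigma_eq_zero_iff] at h
      · refine key x (fun hx ↦ hβ (neg_mem_iff.mp ((L.lattice.add_mem_iff_right hx).mp h))) β
          (by rwa [sub_eq_add_neg]) ?_
        linear_combination hB
      · refine key x (fun hx ↦ hα ((L.lattice.add_mem_iff_right hx).mp h)) (-α)
          (by rwa [sub_neg_eq_add]) ?_
        rw [L.weierstrassP_neg, L.derivWeierstrassP_neg]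
        linear_combination -hA
    · rw [sigma_eq_zero_iff] at h
      refine key x (fun hx ↦ hγ ((L.lattice.add_mem_iff_right hx).mp h)) (-(β - α))
          (by rwa [sub_neg_eq_add]) ?_
      rw [L.weierstrassP_neg, L.derivWeierstrassP_neg]
      linear_combination -hC
  have h0 := hK 0
  rw [sigma_zero, sigmaCubeP'_zero, zero_add, zero_add, zero_add, sigma_neg] at h0
  have hzK := hK z
  rw [← sub_eq_add_neg, sigmaSqP_of_notMem L hz, sigmaCubeP'_of_notMem L hz] at hzK
  linear_combination (sigma L α * sigma L β * sigma L (β - α)) * hzK +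
    (sigma L (z - β) * sigma L (z + α) * sigma L (z + (β - α))) * h0

/-- The addition theorem of `℘` in the generic case. -/
lemma weierstrassP_add_of_generic {x y : ℂ} (hx : x ∉ L.lattice) (hy : y ∉ L.lattice)
    (h1 : x + y ∉ L.lattice) (h2 : x - y ∉ L.lattice) (h3 : 2 * x + y ∉ L.lattice)
    (h4 : x + 2 * y ∉ L.lattice) :
    4 * (L.weierstrassP (x + y) + L.weierstrassP x + L.weierstrassP y) *
        (L.weierstrassP x - L.weierstrassP y) ^ 2 =
      (L.derivWeierstrassP x - L.derivWeierstrassP y) ^ 2 := by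
  have h := weierstrassP_add_add L (w := -(x + y)) hx hy (by rwa [neg_mem_iff]) h2
    (by convert! h3 using 2; ring) (by convert! h4 using 2; ring) (by ring)
  rw [L.weierstrassP_neg] at h
  rw [← h]
  ring

lemma k_apply (α β : ℂ) :
    let a := L.weierstrassP α
    let A := L.derivWeierstrassP α
    let b := L.weierstrassP β
    let B := L.derivWeierstrassP β
    let c := L.weierstrassP (β - α)
    let C := L.derivWeierstrassP (β - α)
    k L α β 0 = A + B ∧
    k L α β 1 = -(b * A + a * B) ∧
    k L α β 2 = b ^ 2 * A + a ^ 2 * B ∧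
    k L α β 3 = b ^ 2 * A + (a ^ 2 - (b - a) * (c - a)) * B ∧
    k L α β 4 = (b ^ 2 - (a - b) * (c - b)) * A + a ^ 2 * B ∧
    k L α β 5 = -(b * (b ^ 2 - (a - b) * (c - b)) * A + a * (a ^ 2 - (b - a) * (c - a)) * B) ∧
    k L α β 6 = (b ^ 2 - (a - b) * (c - b)) ^ 2 * A + (a ^ 2 - (b - a) * (c - a)) ^ 2 * B -
      A * B * C * (a - b) :=
  ⟨rfl, rfl, rfl, rfl, rfl, rfl, rfl⟩

/-- The row vector that represents, up to a factor, the functional `u ↦ u - ℘(z + α)`; the factor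
`σ(z + α)²` makes its entries entire functions of `z`. -/
noncomputable def legRow (α z : ℂ) : Fin 2 → ℂ := ![sigma L (z + α) ^ 2, -sigmaSqP L (z + α)]

/-- The Möbius transformation `u₁ ↦ u₃` defined by Q4 maps `℘(z + α)` to `℘(z + β)` if
`u₀ = ℘(z)`. The parameters are generic here, so that the addition theorem applies. -/
lemma row_mul_rawU_of_generic {α β z : ℂ} (hα : α ∉ L.lattice) (hβ : β ∉ L.lattice)
    (hγ : β - α ∉ L.lattice) (h1 : α + β ∉ L.lattice) (h2 : 2 * α - β ∉ L.lattice)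
    (h3 : 2 * β - α ∉ L.lattice) (hz : z ∉ L.lattice)
    (hv : ∀ v, v = α ∨ v = β ∨ v = β - α → z + v ∉ L.lattice ∧ z - v ∉ L.lattice ∧
      2 * z + v ∉ L.lattice ∧ z + 2 * v ∉ L.lattice) (u₂ : ℂ) (j : Fin 2) :
    sigma L z ^ 2 * (sigma L (z + β) ^ 2 * rawU L (L.weierstrassP z) u₂ α β 0 j -
        sigmaSqP L (z + β) * rawU L (L.weierstrassP z) u₂ α β 1 j) *
        (sigma L α ^ 2 * sigma L (β - α) ^ 2) =
      (L.weierstrassP α - L.weierstrassP β) * L.derivWeierstrassP β * sigma L β ^ 2 *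
        (sigma L (z + (β - α)) ^ 2 * u₂ - sigmaSqP L (z + (β - α))) * legRow L α z j := by
  obtain ⟨m, n, hA, hB, hC, hm⟩ := exists_line L hα hβ hγ h1 h2 h3
  have hline := line_eq_sigma L hα hβ hγ h1 h2 h3 hA hB hC hz
  obtain ⟨vα1, vα2, vα3, vα4⟩ := hv α (.inl rfl)
  obtain ⟨vβ1, vβ2, vβ3, vβ4⟩ := hv β (.inr (.inl rfl))
  obtain ⟨vγ1, vγ2, vγ3, vγ4⟩ := hv (β - α) (.inr (.inr rfl))
  have hQ := weierstrassP_add_of_generic L hz hα vα1 vα2 vα3 vα4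
  have hP := weierstrassP_add_of_generic L hz hβ vβ1 vβ2 vβ3 vβ4
  have hR := weierstrassP_add_of_generic L hz hγ vγ1 vγ2 vγ3 vγ4
  have ua := weierstrassP_ne L hz hα vα1 vα2
  have ub := weierstrassP_ne L hz hβ vβ1 vβ2
  have uc := weierstrassP_ne L hz hγ vγ1 vγ2
  have hab := weierstrassP_ne L hα hβ h1 (by rwa [← neg_sub, neg_mem_iff])
  have hsub := sigma_add_mul_sigma_sub' L hz hβ
  have sz := sigma_ne_zero L hz
  have sα := sigma_ne_zero L hα
  have sβ := sigma_ne_zero L hβ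
  have sγ := sigma_ne_zero L hγ
  have szα := sigma_ne_zero L vα1
  have szβ := sigma_ne_zero L vβ1
  have szβ' := sigma_ne_zero L vβ2
  have szγ := sigma_ne_zero L vγ1
  have qz := L.derivWeierstrassP_sq z hz
  have qa := L.derivWeierstrassP_sq α hα
  have qb := L.derivWeierstrassP_sq β hβ
  have qc := L.derivWeierstrassP_sq (β - α) hγ
  revert j
  rw [Fin.forall_fin_two]
  simp only [rawU, legRow, Matrix.of_apply, Matrix.cons_val', Matrix.cons_val_zero,
    Matrix.cons_val_one, Matrix.cons_val_fin_one]
  rw [sigmaSqP_of_notMem L vα1, sigmaSqP_of_notMem L vβ1, sigmaSqP_of_notMem L vγ1]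
  obtain ⟨e₀, e₁, e₂, e₃, e₄, e₅, e₆⟩ := k_apply L α β
  generalize k L α β 0 = k₀ at *
  generalize k L α β 1 = k₁ at *
  generalize k L α β 2 = k₂ at *
  generalize k L α β 3 = k₃ at *
  generalize k L α β 4 = k₄ at *
  generalize k L α β 5 = k₅ at *
  generalize k L α β 6 = k₆ at *
  generalize L.weierstrassP (z + α) = Q at *
  generalize L.weierstrassP (z + β) = P at *
  generalize L.weierstrassP (z + (β - α)) = R at *
  generalize L.weierstrassP z = u at *
  generalize L.derivWeierstrassP z = u' at *
  generalize L.weierstrassP α = a at *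
  generalize L.weierstrassP β = b at *
  generalize L.weierstrassP (β - α) = c at *
  generalize L.derivWeierstrassP α = A at *
  generalize L.derivWeierstrassP β = B at *
  generalize L.derivWeierstrassP (β - α) = C at *
  generalize sigma L (z + α) = sza at *
  generalize sigma L (z + β) = szb at *
  generalize sigma L (z - β) = szb' at *
  generalize sigma L (z + (β - α)) = szc at *
  generalize sigma L z = s at *
  generalize sigma L α = sa at *
  generalize sigma L β = sb at *
  generalize sigma L (β - α) = sc at *
  obtain ⟨g, hg⟩ : ∃ g, g * (u - b) = u' + m * u + n := ⟨_, div_mul_cancel₀ _ ub⟩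
  -- The cubic minus the square of the line is `4 (t - a) (t - b) (t - c)`.
  have cubic : u' ^ 2 - (m * u + n) ^ 2 = 4 * (u - a) * (u - b) * (u - c) := by
    have g2 : L.g₂ + 2 * m * n = -4 * (a * b + b * c + c * a) := by
      refine mul_right_cancel₀ hab ?_
      linear_combination qa - qb - (A + m * a + n) * hA + (B - (m * b + n)) * hB +
        4 * (a - b) * (a + b) * hm
    have g3 : L.g₃ + n ^ 2 = 4 * a * b * c := by
      linear_combination qb - (B - (m * b + n)) * hB - b * g2 + 4 * b ^ 2 * hm
    linear_combination qz - u * g2 - g3 + 4 * u ^ 2 * hm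
  have h : g * (g * (u - b) - 2 * (m * u + n)) = 4 * (u - a) * (u - c) := by
    refine mul_right_cancel₀ ub ?_
    linear_combination (g * (u - b) + u' - (m * u + n)) * hg + cubic
  have hP' : P = (g - m) ^ 2 / 4 - u - b := by
    refine mul_right_cancel₀ (pow_ne_zero 2 ub) ?_
    have : (g - m) * (u - b) = u' - B := by linear_combination hg + hB
    linear_combination hP / 4 - ((g - m) * (u - b) + (u' - B)) / 4 * this
  have hQ' : 4 * Q * g ^ 2 = (4 * (u - c) + m * g) ^ 2 - 4 * (u + a) * g ^ 2 := by
    refine mul_right_cancel₀ (pow_ne_zero 2 ua) ?_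
    have : (u' - A) * g = (u - a) * (4 * (u - c) + m * g) := by
      linear_combination h - g * hg - g * hA
    linear_combination g ^ 2 * hQ +
      ((u' - A) * g + (u - a) * (4 * (u - c) + m * g)) * this
  have hR' : 4 * R * g ^ 2 = (4 * (u - a) + m * g) ^ 2 - 4 * (u + c) * g ^ 2 := by
    refine mul_right_cancel₀ (pow_ne_zero 2 uc) ?_
    have : (u' - C) * g = (u - c) * (4 * (u - a) + m * g) := by
      linear_combination h - g * hg - g * hC
    linear_combination g ^ 2 * hR +
      ((u' - C) * g + (u - c) * (4 * (u - a) + m * g)) * this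
  have hgs : g * (sa * sc * s * szb) = -2 * (sb * sza * szc) := by
    refine mul_right_cancel₀ szβ' ?_
    linear_combination (g * sa * sc * s) * hsub - (sa * sc * s ^ 3 * sb ^ 2) * hg - sb * hline
  have hg0 : g ≠ 0 := by
    intro hg0
    rw [hg0, zero_mul, eq_comm] at hgs
    exact mul_ne_zero (neg_ne_zero.mpr two_ne_zero) (mul_ne_zero (mul_ne_zero sβ szα) szγ) hgs
  have i0 := leg_leading_coeff hA hB hm h hP' e₀ e₁ e₄
  have i1 := leg_coeff_left hA hB hm h hP' e₁ e₂ e₃ e₅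
  have i2 := leg_coeff_right hA hB hm h hP' e₁ e₂ e₃ e₅
  have i3 := leg_constant_coeff hA hB hC hm h hP' rfl rfl e₄ e₅ e₆
  rw [← hR'] at i1 i3
  rw [← hQ'] at i2 i3
  have i3' : 4 * (k₅ * u + k₆ + P * (k₄ * u + k₅)) = -(a - b) * B * Q * R * g ^ 2 := by
    refine mul_left_cancel₀ (pow_ne_zero 2 hg0) ?_
    linear_combination i3 / 16
  have hgs2 : g ^ 2 * (sa * sc * s * szb) ^ 2 = 4 * (sb * sza * szc) ^ 2 := by
    rw [← mul_pow, hgs]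
    ring
  constructor
  · linear_combination (s ^ 2 * szb ^ 2 * sa ^ 2 * sc ^ 2) * (-u₂ * i0 - i1 / 16) +
      (a - b) * B / 4 * (u₂ - R) * hgs2
  · linear_combination (s ^ 2 * szb ^ 2 * sa ^ 2 * sc ^ 2) * (-u₂ * i2 / 16 - i3' / 4) -
      Q * (a - b) * B / 4 * (u₂ - R) * hgs2

end

/-! ### The three-leg form of Q4 -/

section

variable (L : PeriodPair)

lemma continuousAt_rawU {f g : ℂ → ℂ} {z β : ℂ} (hf : ContinuousAt f z)
    (hg : ∀ i, ContinuousAt (fun w ↦ k L (g w) β i) z) (u₂ : ℂ) (i j : Fin 2) :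
    ContinuousAt (fun w ↦ rawU L (f w) u₂ (g w) β i j) z := by
  obtain ⟨κ, hκ⟩ : ∃ κ : Fin 7 → ℂ → ℂ, ∀ i w, k L (g w) β i = κ i w := ⟨_, fun _ _ ↦ rfl⟩
  have hg : ∀ i, ContinuousAt (κ i) z := fun i ↦ by simpa only [hκ] using hg i
  have h0 := hg 0
  have h1 := hg 1
  have h2 := hg 2
  have h3 := hg 3
  have h4 := hg 4
  have h5 := hg 5
  have h6 := hg 6
  have key : ∀ i j, ContinuousAt (fun w ↦ rawU L (f w) u₂ (g w) β i j) z := by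
    simp only [Fin.forall_fin_two, rawU, hκ, Matrix.of_apply, Matrix.cons_val', Matrix.cons_val_zero,
      Matrix.cons_val_one, Matrix.cons_val_fin_one]
    exact ⟨⟨by fun_prop, by fun_prop⟩, by fun_prop, by fun_prop⟩
  exact key i j

lemma continuousAt_k {α β : ℂ} (hα : α ∉ L.lattice) (hγ : β - α ∉ L.lattice) (i : Fin 7) :
    ContinuousAt (fun α ↦ k L α β i) α := by
  have h1 := continuousAt_weierstrassP L hα
  have h2 := continuousAt_derivWeierstrassP L hα
  have h3 : ContinuousAt (fun α ↦ L.weierstrassP (β - α)) α :=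
    ContinuousAt.comp (f := fun α ↦ β - α) (continuousAt_weierstrassP L hγ) (by fun_prop)
  have h4 : ContinuousAt (fun α ↦ L.derivWeierstrassP (β - α)) α :=
    ContinuousAt.comp (f := fun α ↦ β - α) (continuousAt_derivWeierstrassP L hγ) (by fun_prop)
  fin_cases i <;> simp [k] <;> fun_prop

lemma continuous_sigma : Continuous (sigma L) := (differentiable_sigma L).continuous

lemma continuous_sigmaSqP : Continuous (sigmaSqP L) := (differentiable_sigmaSqP L).continuous

lemma continuous_legRow {f g : ℂ → ℂ} (hf : Continuous f) (hg : Continuous g) (j : Fin 2) :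
    Continuous fun w ↦ legRow L (f w) (g w) j := by
  have h1 := continuous_sigma L
  have h2 := continuous_sigmaSqP L
  have key : ∀ j, Continuous fun w ↦ legRow L (f w) (g w) j := by
    simp only [Fin.forall_fin_two, legRow, Matrix.cons_val_zero, Matrix.cons_val_one,
      Matrix.cons_val_fin_one]
    exact ⟨by fun_prop, by fun_prop⟩
  exact key j

/-- The Möbius transformation `u₁ ↦ u₃` defined by Q4 maps `℘(z + α)` to `℘(z + β)` if
`u₀ = ℘(z)`. This follows from the generic case by continuity, first in `z` and then in `α`. -/
lemma row_mul_rawU {α β z : ℂ} (hα : α ∉ L.lattice) (hβ : β ∉ L.lattice)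
    (hγ : β - α ∉ L.lattice) (hz : z ∉ L.lattice) (u₂ : ℂ) (j : Fin 2) :
    sigma L z ^ 2 * (sigma L (z + β) ^ 2 * rawU L (L.weierstrassP z) u₂ α β 0 j -
        sigmaSqP L (z + β) * rawU L (L.weierstrassP z) u₂ α β 1 j) *
        (sigma L α ^ 2 * sigma L (β - α) ^ 2) =
      (L.weierstrassP α - L.weierstrassP β) * L.derivWeierstrassP β * sigma L β ^ 2 *
        (sigma L (z + (β - α)) ^ 2 * u₂ - sigmaSqP L (z + (β - α))) * legRow L α z j := by
  have hσ := continuous_sigma L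
  have hτ := continuous_sigmaSqP L
  have hpz := continuousAt_weierstrassP L hz
  have hpα := continuousAt_weierstrassP L hα
  have step : ∀ α, α ∉ L.lattice → β - α ∉ L.lattice → α + β ∉ L.lattice →
      2 * α - β ∉ L.lattice → 2 * β - α ∉ L.lattice →
    sigma L z ^ 2 * (sigma L (z + β) ^ 2 * rawU L (L.weierstrassP z) u₂ α β 0 j -
        sigmaSqP L (z + β) * rawU L (L.weierstrassP z) u₂ α β 1 j) *
        (sigma L α ^ 2 * sigma L (β - α) ^ 2) =
      (L.weierstrassP α - L.weierstrassP β) * L.derivWeierstrassP β * sigma L β ^ 2 *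
        (sigma L (z + (β - α)) ^ 2 * u₂ - sigmaSqP L (z + (β - α))) * legRow L α z j := by
    intro α hα hγ h1 h2 h3
    have hr := continuous_legRow L (continuous_const (y := α)) continuous_id j
    simp only [id] at hr
    have c0 := continuousAt_rawU L hpz (fun i ↦ continuousAt_const (y := k L α β i)) u₂ 0 j
    have c1 := continuousAt_rawU L hpz (fun i ↦ continuousAt_const (y := k L α β i)) u₂ 1 j
    have hS : ({z | z ∈ L.lattice} ∪ ⋃ v ∈ ({α, β, β - α} : Set ℂ),
        ({z : ℂ | 1 * z + v ∈ L.lattice} ∪ {z : ℂ | 1 * z + -v ∈ L.lattice} ∪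
          ({z : ℂ | 2 * z + v ∈ L.lattice} ∪ {z : ℂ | 1 * z + 2 * v ∈ L.lattice}))).Countable := by
      refine (countable_lattice L).union (Set.Countable.biUnion (Set.toFinite _).countable ?_)
      intro v _
      exact ((countable_setOf_mul_add_mem L _ one_ne_zero).union
        (countable_setOf_mul_add_mem L _ one_ne_zero)).union
        ((countable_setOf_mul_add_mem L _ two_ne_zero).union
        (countable_setOf_mul_add_mem L _ one_ne_zero))
    refine eq_of_forall_notMem_countable hS (z := z)
      (f := fun z ↦ sigma L z ^ 2 * (sigma L (z + β) ^ 2 * rawU L (L.weierstrassP z) u₂ α β 0 j -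
        sigmaSqP L (z + β) * rawU L (L.weierstrassP z) u₂ α β 1 j) *
        (sigma L α ^ 2 * sigma L (β - α) ^ 2))
      (g := fun z ↦ (L.weierstrassP α - L.weierstrassP β) * L.derivWeierstrassP β *
        sigma L β ^ 2 * (sigma L (z + (β - α)) ^ 2 * u₂ - sigmaSqP L (z + (β - α))) *
          legRow L α z j)
      ((ContinuousAt.mul (by fun_prop) ((ContinuousAt.mul (by fun_prop) c0).sub
        (ContinuousAt.mul (by fun_prop) c1))).mul (by fun_prop)) (by fun_prop) fun w hw ↦ ?_
    simp only [Set.mem_union, Set.mem_ofPred_eq, Set.mem_iUnion, not_or, not_exists,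
      one_mul, ← sub_eq_add_neg] at hw
    refine row_mul_rawU_of_generic L hα hβ hγ h1 h2 h3 hw.1 (fun v hv ↦ ?_) u₂ j
    obtain ⟨⟨a1, a2⟩, a3, a4⟩ := hw.2 v (by simpa using hv)
    exact ⟨a1, a2, a3, a4⟩
  have hS : ({a | a ∈ L.lattice} ∪ {a : ℂ | -1 * a + β ∈ L.lattice} ∪
      ({a : ℂ | 1 * a + β ∈ L.lattice} ∪ ({a : ℂ | 2 * a + -β ∈ L.lattice} ∪
        {a : ℂ | -1 * a + 2 * β ∈ L.lattice}))).Countable :=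
    ((countable_lattice L).union (countable_setOf_mul_add_mem L _ (by norm_num))).union
      ((countable_setOf_mul_add_mem L _ one_ne_zero).union
        ((countable_setOf_mul_add_mem L _ two_ne_zero).union
        (countable_setOf_mul_add_mem L _ (by norm_num))))
  have c0 := continuousAt_rawU L (continuousAt_const (y := L.weierstrassP z))
    (continuousAt_k L hα hγ) u₂ 0 j
  have c1 := continuousAt_rawU L (continuousAt_const (y := L.weierstrassP z))
    (continuousAt_k L hα hγ) u₂ 1 j
  have hr := continuous_legRow L continuous_id (continuous_const (y := z)) j
  simp only [id] at hr
  refine eq_of_forall_notMem_countable hS (z := α)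
      (f := fun α ↦ sigma L z ^ 2 * (sigma L (z + β) ^ 2 * rawU L (L.weierstrassP z) u₂ α β 0 j -
        sigmaSqP L (z + β) * rawU L (L.weierstrassP z) u₂ α β 1 j) *
        (sigma L α ^ 2 * sigma L (β - α) ^ 2))
      (g := fun α ↦ (L.weierstrassP α - L.weierstrassP β) * L.derivWeierstrassP β *
        sigma L β ^ 2 * (sigma L (z + (β - α)) ^ 2 * u₂ - sigmaSqP L (z + (β - α))) *
          legRow L α z j)
      ((ContinuousAt.mul (by fun_prop) ((ContinuousAt.mul (by fun_prop) c0).sub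
        (ContinuousAt.mul (by fun_prop) c1))).mul (by fun_prop)) (by fun_prop) fun w hw ↦ ?_
  simp only [Set.mem_union, Set.mem_ofPred_eq, not_or, one_mul, neg_mul, neg_add_eq_sub,
    ← sub_eq_add_neg] at hw
  exact step w hw.1.1 hw.1.2 hw.2.1 hw.2.2.1 hw.2.2.2

/-- The matrix of the Möbius transformation `u ↦ F(z, x; α)`, `u = ℘(x)`, which is a quotient of
the functionals vanishing at `℘(z + α)` and at `℘(z - α)`. -/
noncomputable def legMatrix (α z : ℂ) : Matrix (Fin 2) (Fin 2) ℂ :=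
  !![sigma L (z + α) ^ 2, -sigmaSqP L (z + α); sigma L (z - α) ^ 2, -sigmaSqP L (z - α)]

lemma det_legMatrix (α z : ℂ) :
    (legMatrix L α z).det = -(sigma L (2 * z) * sigma L (2 * α)) := by
  have hσ := continuous_sigma L
  have hτ := continuous_sigmaSqP L
  rw [legMatrix, Matrix.det_fin_two_of]
  refine eq_of_forall_notMem_countable (countable_setOf_mul_add_mem L (-α) one_ne_zero) (z := z)
    (f := fun z ↦ sigma L (z + α) ^ 2 * -sigmaSqP L (z - α) -
      -sigmaSqP L (z + α) * sigma L (z - α) ^ 2)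
    (g := fun z ↦ -(sigma L (2 * z) * sigma L (2 * α))) (by fun_prop) (by fun_prop) fun w hw ↦ ?_
  simp only [Set.mem_ofPred_eq, one_mul, ← sub_eq_add_neg] at hw
  have := sigma_add_mul_sigma_sub L hw (w + α)
  rw [show w + α + (w - α) = 2 * w by ring, show w + α - (w - α) = 2 * α by ring] at this
  rw [this, sigmaSqP_of_notMem L hw]
  ring

lemma isUnit_det_legMatrix {α z : ℂ} (hα : 2 * α ∉ L.lattice) (hz : 2 * z ∉ L.lattice) :
    IsUnit (legMatrix L α z).det := by
  rw [det_legMatrix, isUnit_iff_ne_zero]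
  exact neg_ne_zero.mpr (mul_ne_zero (sigma_ne_zero L hz) (sigma_ne_zero L hα))

/-- The factor by which the Möbius matrix of Q4 multiplies the functional vanishing at
`℘(z + α)`. -/
noncomputable def legFactor (α β z x₂ : ℂ) : ℂ :=
  (L.weierstrassP α - L.weierstrassP β) * L.derivWeierstrassP β * sigma L β ^ 2 *
    (sigma L (z + (β - α) + x₂) * sigma L (z + (β - α) - x₂)) /
    (sigma L z ^ 2 * sigma L x₂ ^ 2 * sigma L α ^ 2 * sigma L (β - α) ^ 2)

/-- The three-leg form of Q4: conjugation by the leg matrices makes the Möbius matrix of Q4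
diagonal. -/
lemma legMatrix_mul_rawU {α β z x₂ : ℂ} (hα : α ∉ L.lattice) (hβ : β ∉ L.lattice)
    (hγ : β - α ∉ L.lattice) (hz : z ∉ L.lattice) (hx₂ : x₂ ∉ L.lattice) :
    legMatrix L β z * rawU L (L.weierstrassP z) (L.weierstrassP x₂) α β =
      Matrix.diagonal ![legFactor L α β z x₂, legFactor L α β (-z) x₂] * legMatrix L α z := by
  have key : ∀ z, z ∉ L.lattice → ∀ j,
      sigma L (z + β) ^ 2 * rawU L (L.weierstrassP z) (L.weierstrassP x₂) α β 0 j -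
        sigmaSqP L (z + β) * rawU L (L.weierstrassP z) (L.weierstrassP x₂) α β 1 j =
        legFactor L α β z x₂ * legRow L α z j := by
    intro z hz j
    have h := row_mul_rawU L hα hβ hγ hz (L.weierstrassP x₂) j
    have h' := sigma_add_mul_sigma_sub L hx₂ (z + (β - α))
    have := sigma_ne_zero L hz
    have := sigma_ne_zero L hα
    have := sigma_ne_zero L hγ
    have := sigma_ne_zero L hx₂
    rw [legFactor, h', div_mul_eq_mul_div, eq_div_iff (by positivity)]
    linear_combination sigma L x₂ ^ 2 * h
  have h0 := key z hz
  have h1 := key (-z) (neg_mem_iff.not.mpr hz)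
  have e1 : ∀ a, -z + a = -(z - a) := fun a ↦ by ring
  simp only [L.weierstrassP_neg, e1, sigma_neg, sigmaSqP_neg, neg_sq, legRow] at h0 h1
  ext i j
  fin_cases i
  · simp only [Matrix.mul_apply, Fin.sum_univ_two, legMatrix]
    have := h0 j
    fin_cases j <;> simp at this ⊢ <;> linear_combination this
  · simp only [Matrix.mul_apply, Fin.sum_univ_two, legMatrix]
    have := h1 j
    fin_cases j <;> simp at this ⊢ <;> linear_combination this

end

/-! ### Transition matrices and monodromy -/

section

variable (L : PeriodPair)

lemma notMem_of_two_mul_notMem {z : ℂ} (hz : 2 * z ∉ L.lattice) : z ∉ L.lattice :=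
  fun h ↦ hz (by rw [two_mul]; exact add_mem h h)

lemma legFactor_ne_zero {α β z x₂ : ℂ} (hα : α ∉ L.lattice) (hβ : 2 * β ∉ L.lattice)
    (hγ : β - α ∉ L.lattice) (hs : α + β ∉ L.lattice) (hz : z ∉ L.lattice)
    (hx₂ : x₂ ∉ L.lattice) (h1 : z + (β - α) + x₂ ∉ L.lattice)
    (h2 : z + (β - α) - x₂ ∉ L.lattice) : legFactor L α β z x₂ ≠ 0 := by
  have hβ' := notMem_of_two_mul_notMem L hβ
  have hab := weierstrassP_ne L hα hβ' hs (by rwa [← neg_sub, neg_mem_iff])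
  have hB := derivWeierstrassP_ne_zero L hβ
  have := sigma_ne_zero L hα
  have := sigma_ne_zero L hβ'
  have := sigma_ne_zero L hγ
  have := sigma_ne_zero L hz
  have := sigma_ne_zero L hx₂
  have := sigma_ne_zero L h1
  have := sigma_ne_zero L h2
  unfold legFactor
  positivity

/-- The ratio of the two diagonal entries in the three-leg form of Q4 is the long leg. -/
lemma legFactor_neg (α β z x₂ : ℂ) (h1 : z + (β - α) + x₂ ∉ L.lattice)
    (h2 : z + (β - α) - x₂ ∉ L.lattice) :
    legFactor L α β (-z) x₂ = F L z x₂ (α - β) * legFactor L α β z x₂ := by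
  have s1 := sigma_ne_zero L h1
  have s2 := sigma_ne_zero L h2
  have e1 : -z + (β - α) + x₂ = -(z - x₂ + (α - β)) := by ring
  have e2 : -z + (β - α) - x₂ = -(z + x₂ + (α - β)) := by ring
  have e3 : z + x₂ - (α - β) = z + (β - α) + x₂ := by ring
  have e4 : z - x₂ - (α - β) = z + (β - α) - x₂ := by ring
  rw [legFactor, legFactor, F, e1, e2, e3, e4, sigma_neg, sigma_neg, sigma_neg]
  field_simp

lemma det_rawU {α β z x₂ : ℂ} (hα : α ∉ L.lattice) (hβ : 2 * β ∉ L.lattice)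
    (hγ : β - α ∉ L.lattice) (hz : z ∉ L.lattice) (hx₂ : x₂ ∉ L.lattice) :
    sigma L (2 * β) * (rawU L (L.weierstrassP z) (L.weierstrassP x₂) α β).det =
      sigma L (2 * α) * (legFactor L α β z x₂ * legFactor L α β (-z) x₂) := by
  have hβ' := notMem_of_two_mul_notMem L hβ
  have hp := continuousAt_weierstrassP L hz
  have hσ := continuous_sigma L
  have hc := fun i j ↦ continuousAt_rawU L hp
    (fun i ↦ continuousAt_const (y := k L α β i)) (L.weierstrassP x₂) i j
  have hdet : ContinuousAt
      (fun z ↦ (rawU L (L.weierstrassP z) (L.weierstrassP x₂) α β).det) z := by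
    simp only [Matrix.det_fin_two]
    exact ((hc 0 0).mul (hc 1 1)).sub ((hc 0 1).mul (hc 1 0))
  have hleg : ∀ w, w ∉ L.lattice → ContinuousAt (fun z ↦ legFactor L α β z x₂) w := by
    intro w hw
    have := sigma_ne_zero L hα
    have := sigma_ne_zero L hγ
    have := sigma_ne_zero L hx₂
    have := sigma_ne_zero L hw
    unfold legFactor
    exact ContinuousAt.div (by fun_prop) (by fun_prop) (by positivity)
  have hleg' : ContinuousAt (fun z ↦ legFactor L α β (-z) x₂) z :=
    ContinuousAt.comp (f := fun z ↦ -z) (hleg (-z) (neg_mem_iff.not.mpr hz)) (by fun_prop)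
  refine eq_of_forall_notMem_countable (z := z)
    ((countable_lattice L).union (countable_setOf_mul_add_mem L 0 two_ne_zero))
    (continuousAt_const.mul hdet) (continuousAt_const.mul ((hleg z hz).mul hleg'))
    fun w hw ↦ ?_
  simp only [Set.mem_union, Set.mem_ofPred_eq, not_or, add_zero] at hw
  have h := congrArg Matrix.det (legMatrix_mul_rawU L hα hβ' hγ hw.1 hx₂)
  rw [Matrix.det_mul, Matrix.det_mul, Matrix.det_diagonal, Fin.prod_univ_two, det_legMatrix,
    det_legMatrix] at h
  simp only [Matrix.cons_val_zero, Matrix.cons_val_one, Matrix.cons_val_fin_one] at h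
  refine mul_left_cancel₀ (sigma_ne_zero L hw.2) ?_
  simp only [Pi.mul_apply]
  linear_combination -h

lemma det_rawU_ne_zero {α β z x₂ : ℂ} (hα : 2 * α ∉ L.lattice) (hβ : 2 * β ∉ L.lattice)
    (hγ : β - α ∉ L.lattice) (hs : α + β ∉ L.lattice) (hz : z ∉ L.lattice)
    (hx₂ : x₂ ∉ L.lattice) (h1 : z + (β - α) + x₂ ∉ L.lattice)
    (h2 : z + (β - α) - x₂ ∉ L.lattice) (h3 : -z + (β - α) + x₂ ∉ L.lattice)
    (h4 : -z + (β - α) - x₂ ∉ L.lattice) :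
    (rawU L (L.weierstrassP z) (L.weierstrassP x₂) α β).det ≠ 0 := by
  have hα' := notMem_of_two_mul_notMem L hα
  intro h
  have := det_rawU L hα' hβ hγ hz hx₂
  rw [h, mul_zero, eq_comm] at this
  exact mul_ne_zero (sigma_ne_zero L hα)
    (mul_ne_zero (legFactor_ne_zero L hα' hβ hγ hs hz hx₂ h1 h2)
      (legFactor_ne_zero L hα' hβ hγ hs (neg_mem_iff.not.mpr hz) hx₂ h3 h4)) this

section Edge

variable {V D : Type*} {G : EmbeddedGraph V D} {α : G.Labelling} {L}

/-- The genericity conditions of an edge, in the form in which the three-leg form needs them. -/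
lemma RegularEdge.spec {x : V → ℂ} {lam : ℂ} {d : D} (h : RegularEdge L G α x d)
    (ha : AdmissibleEdge L G α lam d) :
    let z := x (G.src d)
    let x₂ := x (G.tgt d)
    let a := α.val d + lam
    let b := α.val (G.rot d) + lam
    (z ∉ L.lattice ∧ x₂ ∉ L.lattice ∧ b - a ∉ L.lattice) ∧
      (2 * a ∉ L.lattice ∧ 2 * b ∉ L.lattice ∧ a + b ∉ L.lattice) ∧
      z + (b - a) + x₂ ∉ L.lattice ∧ z + (b - a) - x₂ ∉ L.lattice ∧
      -z + (b - a) + x₂ ∉ L.lattice ∧ -z + (b - a) - x₂ ∉ L.lattice := by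
  obtain ⟨h1, h2, h3, h4, h5, h6, h7⟩ := h
  refine ⟨⟨h1, h2, ?_⟩, ha, ?_, ?_, ?_, ?_⟩
  · rw [← neg_mem_iff]; convert! h3 using 2; ring
  · convert! h5 using 2; ring
  · convert! h7 using 2; ring
  · rw [← neg_mem_iff]; convert! h6 using 2; ring
  · rw [← neg_mem_iff]; convert! h4 using 2; ring

lemma transition_eq_smul (x : V → ℂ) (lam : ℂ) (d : D) (h : RegularEdge L G α x d)
    (ha : AdmissibleEdge L G α lam d) :
    ∃ t : ℂ, t ≠ 0 ∧ t ^ 2 * (rawU L (L.weierstrassP (x (G.src d)))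
        (L.weierstrassP (x (G.tgt d))) (α.val d + lam) (α.val (G.rot d) + lam)).det = 1 ∧
      transition L G α x lam d = t • rawU L (L.weierstrassP (x (G.src d)))
        (L.weierstrassP (x (G.tgt d))) (α.val d + lam) (α.val (G.rot d) + lam) := by
  obtain ⟨⟨h1, h2, h3⟩, ⟨h4, h5, h6⟩, h7, h8, h9, h10⟩ := h.spec ha
  have hdet := det_rawU_ne_zero L h4 h5 h3 h6 h1 h2 h7 h8 h9 h10
  have hsq := Complex.cpow_nat_inv_pow (rawU L (L.weierstrassP (x (G.src d)))
    (L.weierstrassP (x (G.tgt d))) (α.val d + lam) (α.val (G.rot d) + lam)).det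
    two_ne_zero
  rw [Nat.cast_ofNat, ← one_div] at hsq
  refine ⟨_, ?_, ?_, rfl⟩
  · refine inv_ne_zero fun h ↦ hdet ?_
    rw [← hsq, h, zero_pow two_ne_zero]
  · rw [inv_pow, hsq, inv_mul_cancel₀ hdet]

lemma det_transition (x : V → ℂ) (lam : ℂ) (d : D) (h : RegularEdge L G α x d)
    (ha : AdmissibleEdge L G α lam d) : (transition L G α x lam d).det = 1 := by
  obtain ⟨t, -, ht, e⟩ := transition_eq_smul x lam d h ha
  rw [e, Matrix.det_smul, Fintype.card_fin, ht]

lemma Q4_eq_zero_iff_transition (x : V → ℂ) (lam : ℂ) (d : D) (h : RegularEdge L G α x d)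
    (ha : AdmissibleEdge L G α lam d) (u₁ u₃ : ℂ) :
    Q4 L (L.weierstrassP (x (G.src d))) u₁ (L.weierstrassP (x (G.tgt d))) u₃
        (α.val d + lam) (α.val (G.rot d) + lam) = 0 ↔
      u₃ * (transition L G α x lam d 1 0 * u₁ + transition L G α x lam d 1 1) =
        transition L G α x lam d 0 0 * u₁ + transition L G α x lam d 0 1 := by
  obtain ⟨t, ht, -, e⟩ := transition_eq_smul x lam d h ha
  rw [e, Q4_eq, ← sub_eq_zero (b := _ + _), ← mul_right_inj' ht, mul_zero]
  refine Eq.congr ?_ rfl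
  simp only [rawU, Matrix.smul_apply, smul_eq_mul, Matrix.of_apply, Matrix.cons_val',
    Matrix.cons_val_zero, Matrix.cons_val_one, Matrix.cons_val_fin_one]
  ring

lemma RegularEdge.rev {x : V → ℂ} {d : D} (h : RegularEdge L G α x d) :
    RegularEdge L G α x (G.rev d) := by
  obtain ⟨h1, h2, h3, h4, h5, h6, h7⟩ := h
  have e1 : G.tgt (G.rev d) = G.src d := by rw [EmbeddedGraph.tgt, G.rev_rev]
  have e2 : G.src (G.rev d) = G.tgt d := rfl
  refine ⟨h2, ?_, ?_, ?_, ?_, ?_, ?_⟩ <;> simp only [e1, e2, α.val_rev, α.val_rot_rev]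
  · exact h1
  · exact h3
  · rwa [add_comm (x _)]
  · rwa [add_comm (x _)]
  · rw [← neg_mem_iff]; convert! h7 using 2; ring
  · rw [← neg_mem_iff]; convert! h6 using 2; ring

lemma AdmissibleEdge.rev {lam : ℂ} {d : D} (h : AdmissibleEdge L G α lam d) :
    AdmissibleEdge L G α lam (G.rev d) := by
  unfold AdmissibleEdge
  rwa [α.val_rev, α.val_rot_rev]

/-- Interchanging `u₀` and `u₂` replaces the Möbius matrix of Q4 by minus its adjugate. -/
lemma isScalar_transition_rev_mul (x : V → ℂ) (lam : ℂ) (d : D) (h : RegularEdge L G α x d)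
    (ha : AdmissibleEdge L G α lam d) :
    IsScalar (transition L G α x lam (G.rev d) * transition L G α x lam d) := by
  obtain ⟨t, -, -, e⟩ := transition_eq_smul x lam d h ha
  obtain ⟨t', -, -, e'⟩ := transition_eq_smul x lam (G.rev d) h.rev ha.rev
  have e1 : G.tgt (G.rev d) = G.src d := by rw [EmbeddedGraph.tgt, G.rev_rev]
  have e2 : G.src (G.rev d) = G.tgt d := rfl
  rw [e1, e2, α.val_rev, α.val_rot_rev] at e'
  have hadj : ∀ u₀ u₂ a b, rawU L u₂ u₀ a b = -(rawU L u₀ u₂ a b).adjugate := by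
    intro u₀ u₂ a b
    rw [rawU, rawU, Matrix.adjugate_fin_two_of]
    ext i j
    fin_cases i <;> fin_cases j <;> simp <;> ring
  rw [e, e', hadj, Matrix.smul_mul, Matrix.mul_smul, neg_mul, Matrix.adjugate_mul, smul_smul,
    ← neg_smul, smul_smul]
  exact ⟨_, rfl⟩

/-- In the frame of the leg matrices, the transition matrix across an edge is diagonal. -/
lemma legMatrix_mul_transition (x : V → ℂ) (lam : ℂ) (d : D) (h : RegularEdge L G α x d)
    (ha : AdmissibleEdge L G α lam d) :
    ∃ p : ℂ, p ≠ 0 ∧ legMatrix L (α.val (G.rot d) + lam) (x (G.src d)) *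
        transition L G α x lam d =
      Matrix.diagonal ![p, F L (x (G.src d)) (x (G.tgt d)) (α.val d - α.val (G.rot d)) * p] *
        legMatrix L (α.val d + lam) (x (G.src d)) := by
  obtain ⟨⟨h1, h2, h3⟩, ⟨h4, h5, h6⟩, h7, h8, h9, h10⟩ := h.spec ha
  obtain ⟨t, ht, -, e⟩ := transition_eq_smul x lam d h ha
  have hα' := notMem_of_two_mul_notMem L h4
  have hleg := legMatrix_mul_rawU L hα' (notMem_of_two_mul_notMem L h5) h3 h1 h2
  rw [legFactor_neg L _ _ _ _ h7 h8, add_sub_add_right_eq_sub] at hleg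
  refine ⟨_, mul_ne_zero ht (legFactor_ne_zero L hα' h5 h3 h6 h1 h2 h7 h8), ?_⟩
  rw [e, Matrix.mul_smul, hleg, ← Matrix.smul_mul, ← Matrix.diagonal_smul]
  congr 2
  ext i
  fin_cases i
  · simp
  · simp
    ring

end Edge

section Star

variable {V D : Type*} {G : EmbeddedGraph V D} {α : G.Labelling} {L}

lemma star_succ (d : D) (j : ℕ) : G.star d (j + 1) = G.rot (G.star d j) :=
  Function.iterate_succ_apply' _ _ _

lemma src_star (d : D) (j : ℕ) : G.src (G.star d j) = G.src d := by
  rw [G.src_eq_iff]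
  refine Equiv.Perm.SameCycle.symm ⟨j, ?_⟩
  rw [zpow_natCast, Equiv.Perm.coe_pow]
  rfl

lemma star_valence (d : D) : G.star d (G.valence d) = d := Function.iterate_minimalPeriod

/-- In the frame of the leg matrices, the product of the transition matrices across the first
`m` edges of a star is diagonal, and the ratio of its diagonal entries is the partial product of
the discrete Toda equation. -/
lemma legMatrix_mul_transitionProd (x : V → ℂ) (lam : ℂ) (d : D) (h : RegularStar L G α x d)
    (ha : AdmissibleStar L G α lam d) (m : ℕ) :
    ∃ p : ℂ, p ≠ 0 ∧ legMatrix L (α.val (G.star d m) + lam) (x (G.src d)) *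
        transitionProd L G α x lam d m =
      Matrix.diagonal ![p, (∏ j ∈ Finset.range m, F L (x (G.src d)) (x (G.tgt (G.star d j)))
          (α.val (G.star d j) - α.val (G.star d (j + 1)))) * p] *
        legMatrix L (α.val d + lam) (x (G.src d)) := by
  induction m with
  | zero =>
    refine ⟨1, one_ne_zero, ?_⟩
    have : (![1, 1] : Fin 2 → ℂ) = 1 := by ext i; fin_cases i <;> rfl
    simp [transitionProd, EmbeddedGraph.star, this]
  | succ m ih =>
    obtain ⟨p, hp, ih⟩ := ih
    obtain ⟨q, hq, hT⟩ := legMatrix_mul_transition x lam (G.star d m) (h.2 _ (src_star d m))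
      (ha _ (src_star d m))
    rw [src_star] at hT
    refine ⟨q * p, mul_ne_zero hq hp, ?_⟩
    rw [transitionProd, star_succ, ← Matrix.mul_assoc, hT, Matrix.mul_assoc, ih,
      ← Matrix.mul_assoc, Matrix.diagonal_mul_diagonal, Finset.prod_range_succ, star_succ]
    congr 2
    ext i
    fin_cases i
    · simp
    · simp
      ring

lemma todaAt_iff_isScalar_monodromy (x : V → ℂ) (lam : ℂ) (d : D) (h : RegularStar L G α x d)
    (ha : AdmissibleStar L G α lam d) :
    TodaAt L G α x d ↔ IsScalar (monodromy L G α x lam d) := by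
  obtain ⟨p, hp, hM⟩ := legMatrix_mul_transitionProd x lam d h ha (G.valence d)
  rw [star_valence] at hM
  have htoda : TodaAt L G α x d ↔ ∏ j ∈ Finset.range (G.valence d),
      F L (x (G.src d)) (x (G.tgt (G.star d j)))
        (α.val (G.star d j) - α.val (G.star d (j + 1))) = 1 := by
    rw [TodaAt, todaProd, Finset.prod_range]
  rw [htoda, monodromy]
  generalize transitionProd L G α x lam d (G.valence d) = M at hM
  generalize ∏ j ∈ Finset.range (G.valence d), F L (x (G.src d)) (x (G.tgt (G.star d j)))
    (α.val (G.star d j) - α.val (G.star d (j + 1))) = E at hM ⊢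
  have hU := isUnit_det_legMatrix L (ha d rfl).1 h.1
  generalize legMatrix L (α.val d + lam) (x (G.src d)) = B at hM hU
  have hU' : IsUnit B := (Matrix.isUnit_iff_isUnit_det B).mpr hU
  have hdiag : ∀ c : ℂ, (![c, c] : Fin 2 → ℂ) = fun _ ↦ c := by
    intro c; ext i; fin_cases i <;> rfl
  constructor
  · rintro rfl
    refine ⟨p, hU'.mul_left_cancel ?_⟩
    rw [hM, one_mul, hdiag, Matrix.mul_smul, mul_one, ← Matrix.smul_eq_diagonal_mul]
  · rintro ⟨c, rfl⟩
    rw [Matrix.mul_smul, mul_one, Matrix.smul_eq_diagonal_mul] at hM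
    have h1 := Matrix.diagonal_injective (hU'.mul_right_cancel hM)
    have e0 : c = p := congrFun h1 0
    have e1 : c = E * p := congrFun h1 1
    refine mul_right_cancel₀ hp ?_
    rw [← e1, one_mul, e0]

/-- Only countably many spectral parameters are excluded, because the star has countably many
edges. -/
lemma exists_admissibleStar (L : PeriodPair) (α : G.Labelling) (d : D) :
    ∃ lam, AdmissibleStar L G α lam d := by
  have hS : (⋃ i : ℤ, ({w : ℂ | 2 * w + 2 * α.val ((G.rot ^ i) d) ∈ L.lattice} ∪
      {w : ℂ | 2 * w + 2 * α.val (G.rot ((G.rot ^ i) d)) ∈ L.lattice} ∪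
      {w : ℂ | 2 * w + (α.val ((G.rot ^ i) d) + α.val (G.rot ((G.rot ^ i) d))) ∈
        L.lattice})).Countable :=
    Set.countable_iUnion fun i ↦ ((countable_setOf_mul_add_mem L _ two_ne_zero).union
      (countable_setOf_mul_add_mem L _ two_ne_zero)).union
      (countable_setOf_mul_add_mem L _ two_ne_zero)
  obtain ⟨lam, hlam⟩ := (hS.dense_compl ℝ).nonempty
  refine ⟨lam, fun e he ↦ ?_⟩
  obtain ⟨i, rfl⟩ := (G.src_eq_iff d e).mp he.symm
  simp only [Set.mem_compl_iff, Set.mem_iUnion, not_exists, Set.mem_union, Set.mem_ofPred_eq,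
    not_or] at hlam
  obtain ⟨⟨h1, h2⟩, h3⟩ := hlam i
  refine ⟨?_, ?_, ?_⟩
  · convert! h1 using 2; ring
  · convert! h2 using 2; ring
  · convert! h3 using 2; ring

end Star

end

/-! ### Rationality of the discrete Toda equation -/

section

variable (L : PeriodPair)

/-- An even theta function of weight `2 m` is a form of degree `m` in `σ²` and `σ² ℘`: subtracting
a multiple of `(σ² ℘)ᵐ` makes it divisible by `σ²`. -/
lemma IsTheta.exists_polynomial {m : ℕ} {f : ℂ → ℂ} (hf : IsTheta L (2 * m) 0 f)
    (heven : ∀ z, f (-z) = f z) :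
    ∃ p : Polynomial ℂ, ∀ z, z ∉ L.lattice →
      f z = sigma L z ^ (2 * m) * p.eval (L.weierstrassP z) := by
  induction m generalizing f with
  | zero =>
    refine ⟨Polynomial.C (f 0), fun z _ ↦ ?_⟩
    rw [hf.eq_const z]
    simp
  | succ m ih =>
    have hτ : IsTheta L (2 * (m + 1)) 0 (fun z ↦ sigmaSqP L z ^ (m + 1)) := by
      convert! (isTheta_sigmaSqP L).pow (m + 1) using 1
      · ring
      · simp
    have hg := hf.sub (hτ.const_mul (f 0))
    have hg_even : ∀ z, f (-z) - f 0 * sigmaSqP L (-z) ^ (m + 1) =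
        f z - f 0 * sigmaSqP L z ^ (m + 1) := fun z ↦ by rw [heven, sigmaSqP_neg]
    have hg0 : f 0 - f 0 * sigmaSqP L 0 ^ (m + 1) = 0 := by rw [sigmaSqP_zero]; ring
    generalize hgdef : (fun z ↦ f z - f 0 * sigmaSqP L z ^ (m + 1)) = g at hg
    have hgz : ∀ z, f z - f 0 * sigmaSqP L z ^ (m + 1) = g z := congrFun hgdef
    simp only [hgz] at hg_even hg0
    obtain ⟨q₁, hq₁, e₁⟩ := IsTheta.exists_eq_mul (m := 2 * m + 1) (m' := 1) (s := 0) (s' := 0)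
      (by simpa [mul_add] using hg) isTheta_sigma simpleZeros_sigma
      fun z hz ↦ hg.eq_zero_of_sub_mem (w := 0)
        (by simpa using (sigma_eq_zero_iff L).mp hz) hg0
    have hodd : ∀ z, q₁ (-z) = -q₁ z := by
      have hc := hq₁.continuous
      refine simpleZeros_sigma.cancel (differentiable_sigma L) (f := fun z ↦ q₁ (-z))
        (g := fun z ↦ -q₁ z) (by fun_prop) (by fun_prop) fun z ↦ ?_
      have := hg_even z
      rw [e₁, e₁ z, sigma_neg] at this
      linear_combination -this
    have hq₁0 : q₁ 0 = 0 := by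
      have := hodd 0
      rw [neg_zero] at this
      linear_combination this / 2
    obtain ⟨q₂, hq₂, e₂⟩ := IsTheta.exists_eq_mul (m := 2 * m) (m' := 1) (s := 0) (s' := 0)
      (by simpa using hq₁) isTheta_sigma simpleZeros_sigma
      fun z hz ↦ hq₁.eq_zero_of_sub_mem (w := 0)
        (by simpa using (sigma_eq_zero_iff L).mp hz) hq₁0
    have heven₂ : ∀ z, q₂ (-z) = q₂ z := by
      have hc := hq₂.continuous
      refine simpleZeros_sigma.cancel (differentiable_sigma L) (f := fun z ↦ q₂ (-z))
        (g := fun z ↦ q₂ z) (by fun_prop) (by fun_prop) fun z ↦ ?_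
      have := hodd z
      rw [e₂, e₂ z, sigma_neg] at this
      linear_combination -this
    obtain ⟨p, hp⟩ := ih hq₂ heven₂
    refine ⟨p + Polynomial.C (f 0) * Polynomial.X ^ (m + 1), fun z hz ↦ ?_⟩
    have h1 : f z = g z + f 0 * sigmaSqP L z ^ (m + 1) := by rw [← hgz]; ring
    rw [h1, e₁, e₂, hp z hz, sigmaSqP_of_notMem L hz]
    simp
    ring

/-- The coefficient of `∏_{j ∈ S} u_j` in the expansion of
`∏ (σ(x + δ_j)² u_j - σ(x + δ_j)² ℘(x + δ_j))`. -/
noncomputable def legCoeff {n : ℕ} (δ : Fin n → ℂ) (S : Finset (Fin n)) (x : ℂ) : ℂ :=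
  (∏ j ∈ S, sigma L (x + δ j) ^ 2) * ∏ j ∈ Finset.univ \ S, -sigmaSqP L (x + δ j)

lemma isTheta_legCoeff {n : ℕ} {δ : Fin n → ℂ} (hδ : ∑ j, δ j = 0) (S : Finset (Fin n)) :
    IsTheta L (2 * n) 0 (legCoeff L δ S) := by
  have h1 := IsTheta.prod S (m := 2) (s := fun j ↦ 2 * δ j)
    (f := fun j x ↦ sigma L (x + δ j) ^ 2)
    (fun j _ ↦ by simpa using (isTheta_sigma_add (L := L) (δ j)).pow 2)
  have h2 := IsTheta.prod (Finset.univ \ S) (m := 2) (s := fun j ↦ 2 * δ j)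
    (f := fun j x ↦ -sigmaSqP L (x + δ j))
    (fun j _ ↦ by simpa using ((isTheta_sigmaSqP L).comp_add (δ j)).const_mul (-1))
  convert! h1.mul h2 using 1
  · rw [← add_mul, add_comm S.card, Finset.card_sdiff_add_card_eq_card (Finset.subset_univ S),
      Finset.card_univ, Fintype.card_fin, mul_comm]
  · rw [add_comm, Finset.sum_sdiff (Finset.subset_univ S), ← Finset.mul_sum, hδ, mul_zero]

lemma legCoeff_neg {n : ℕ} (δ : Fin n → ℂ) (S : Finset (Fin n)) (x : ℂ) :
    legCoeff L δ S (-x) = legCoeff L (fun j ↦ -δ j) S x := by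
  have e : ∀ j, -x + δ j = -(x + -δ j) := fun j ↦ by ring
  simp only [legCoeff, e, sigma_neg, sigmaSqP_neg, neg_sq]

lemma prod_sigma_eq {n : ℕ} (δ : Fin n → ℂ) {y : Fin n → ℂ} (hy : ∀ j, y j ∉ L.lattice)
    (x : ℂ) :
    ∏ j, (sigma L (x + y j + δ j) * sigma L (x - y j + δ j)) =
      (∏ j, sigma L (y j) ^ 2) *
        ∑ S : Finset (Fin n), legCoeff L δ S x * ∏ j ∈ S, L.weierstrassP (y j) := by
  have h : ∀ j, sigma L (x + y j + δ j) * sigma L (x - y j + δ j) = sigma L (y j) ^ 2 *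
      (sigma L (x + δ j) ^ 2 * L.weierstrassP (y j) + -sigmaSqP L (x + δ j)) := by
    intro j
    rw [add_right_comm, show x - y j + δ j = x + δ j - y j by ring, sigma_add_mul_sigma_sub L (hy j)]
    ring
  simp only [h]
  rw [Finset.prod_mul_distrib, Finset.prod_add, Finset.powerset_univ]
  congr 1
  refine Finset.sum_congr rfl fun S _ ↦ ?_
  rw [Finset.prod_mul_distrib, legCoeff]
  ring

/-- At a point of order two modulo the lattice, a theta function of even weight and trivial
characteristic takes the same value as at the opposite point. -/
lemma IsTheta.eq_neg_of_two_mul_mem {m : ℕ} {f : ℂ → ℂ} (hf : IsTheta L (2 * m) 0 f) {x : ℂ}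
    (hx : x ∉ L.lattice) (h2 : 2 * x ∈ L.lattice) : f x = f (-x) := by
  have h := hf.add_coe (-x) ⟨2 * x, h2⟩
  have hσ := sigma_add_coe L (-x) ⟨2 * x, h2⟩
  simp only [show -x + 2 * x = x by ring] at h hσ
  rw [sigma_neg] at hσ
  have hμ : quasiConst L ⟨2 * x, h2⟩ * Complex.exp (quasiExp L ⟨2 * x, h2⟩ * -x) = -1 := by
    refine mul_right_cancel₀ (sigma_ne_zero L hx) ?_
    linear_combination hσ
  rw [h, hμ]
  simp

/-- The discrete Toda equation with vanishing sum of the parameters is polynomial in the values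
of `℘`. -/
lemma exists_todaPolynomial {n : ℕ} (δ : Fin n → ℂ) (hδ : ∑ j, δ j = 0) :
    ∃ P : MvPolynomial (Fin (n + 1)) ℂ, ∀ (x₀ : ℂ) (y : Fin n → ℂ), x₀ ∉ L.lattice →
      (∀ j, y j ∉ L.lattice) →
      (∀ j, x₀ + y j - δ j ∉ L.lattice ∧ x₀ - y j - δ j ∉ L.lattice) →
      (∏ j, F L x₀ (y j) (δ j) = 1 ↔
        MvPolynomial.eval (Fin.cons (L.weierstrassP x₀) (fun j ↦ L.weierstrassP (y j)) :
          Fin (n + 1) → ℂ) P = 0) := by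
  -- The odd part of a coefficient, times `σ⁴ ℘'`, is an even theta function.
  have hp : ∀ S : Finset (Fin n), ∃ p : Polynomial ℂ, ∀ z, z ∉ L.lattice →
      (legCoeff L δ S z - legCoeff L δ S (-z)) * (sigma L z * sigmaCubeP' L z) =
        sigma L z ^ (2 * (n + 2)) * p.eval (L.weierstrassP z) := by
    intro S
    have hc := isTheta_legCoeff L hδ S
    have hc' : IsTheta L (2 * n) 0 (fun z ↦ legCoeff L δ S (-z)) := by
      simp only [legCoeff_neg]
      exact isTheta_legCoeff L (δ := fun j ↦ -δ j) (by simp [hδ]) S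
    have h := (hc.sub hc').mul ((isTheta_sigma (L := L)).mul (isTheta_sigmaCubeP' L))
    refine IsTheta.exists_polynomial L (m := n + 2) (by convert! h using 1; simp) fun z ↦ ?_
    rw [neg_neg, sigma_neg, sigmaCubeP'_neg]
    ring
  choose p hp using hp
  refine ⟨∑ S : Finset (Fin n), Polynomial.aeval (MvPolynomial.X 0) (p S) *
    ∏ j ∈ S, MvPolynomial.X j.succ, fun x₀ y hx₀ hy hD ↦ ?_⟩
  have heval : ∀ S, MvPolynomial.eval
      (Fin.cons (L.weierstrassP x₀) (fun j ↦ L.weierstrassP (y j)) : Fin (n + 1) → ℂ)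
      (Polynomial.aeval (MvPolynomial.X 0) (p S)) = (p S).eval (L.weierstrassP x₀) := by
    intro S
    rw [← MvPolynomial.coe_aeval_eq_eval, RingHom.coe_coe, ← Polynomial.aeval_algHom_apply,
      MvPolynomial.aeval_X, Fin.cons_zero, Polynomial.coe_aeval_eq_eval]
  rw [map_sum]
  simp only [map_mul, map_prod, heval, MvPolynomial.eval_X, Fin.cons_succ]
  have hσ0 := sigma_ne_zero L hx₀
  have hσy : ∏ j, sigma L (y j) ^ 2 ≠ 0 :=
    Finset.prod_ne_zero_iff.mpr fun j _ ↦ pow_ne_zero 2 (sigma_ne_zero L (hy j))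
  have hnum := prod_sigma_eq L δ hy x₀
  have hden : ∏ j, (sigma L (x₀ + y j - δ j) * sigma L (x₀ - y j - δ j)) =
      (∏ j, sigma L (y j) ^ 2) *
        ∑ S : Finset (Fin n), legCoeff L δ S (-x₀) * ∏ j ∈ S, L.weierstrassP (y j) := by
    have h := prod_sigma_eq L (fun j ↦ -δ j) hy x₀
    simp only [← sub_eq_add_neg] at h
    simp only [h, legCoeff_neg]
  have hden0 : ∏ j, (sigma L (x₀ + y j - δ j) * sigma L (x₀ - y j - δ j)) ≠ 0 :=
    Finset.prod_ne_zero_iff.mpr fun j _ ↦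
      mul_ne_zero (sigma_ne_zero L (hD j).1) (sigma_ne_zero L (hD j).2)
  have hT : ∏ j, F L x₀ (y j) (δ j) = 1 ↔ ∑ S : Finset (Fin n),
      (legCoeff L δ S x₀ - legCoeff L δ S (-x₀)) * ∏ j ∈ S, L.weierstrassP (y j) = 0 := by
    simp only [F]
    rw [Finset.prod_div_distrib, div_eq_one_iff_eq hden0, hnum, hden, mul_right_inj' hσy,
      ← sub_eq_zero, ← Finset.sum_sub_distrib]
    simp only [sub_mul]
  have hsum : (∑ S : Finset (Fin n), (legCoeff L δ S x₀ - legCoeff L δ S (-x₀)) *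
        ∏ j ∈ S, L.weierstrassP (y j)) * (sigma L x₀ * sigmaCubeP' L x₀) =
      sigma L x₀ ^ (2 * (n + 2)) * ∑ S : Finset (Fin n),
        (p S).eval (L.weierstrassP x₀) * ∏ j ∈ S, L.weierstrassP (y j) := by
    rw [Finset.sum_mul, Finset.mul_sum]
    refine Finset.sum_congr rfl fun S _ ↦ ?_
    linear_combination (∏ j ∈ S, L.weierstrassP (y j)) * hp S x₀ hx₀
  rw [hT]
  constructor
  · intro h
    rw [h, zero_mul, eq_comm] at hsum
    exact (mul_eq_zero.mp hsum).resolve_left (pow_ne_zero _ hσ0)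
  · intro h
    by_cases h2 : 2 * x₀ ∈ L.lattice
    · -- The factor `℘'` vanishes here, but so do the odd parts of all coefficients.
      refine Finset.sum_eq_zero fun S _ ↦ ?_
      rw [← (isTheta_legCoeff L hδ S).eq_neg_of_two_mul_mem L hx₀ h2, sub_self, zero_mul]
    · rw [h, mul_zero] at hsum
      refine (mul_eq_zero.mp hsum).resolve_right (mul_ne_zero hσ0 ?_)
      rw [sigmaCubeP'_of_notMem L hx₀]
      exact mul_ne_zero (pow_ne_zero 3 hσ0) (derivWeierstrassP_ne_zero L h2)

end

end DiscreteToda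

theorem mainTheorem3 (L : PeriodPair) {V D : Type*} (G : DiscreteToda.EmbeddedGraph V D)
    (α : G.Labelling) :
    -- Rationality of the Toda equation at every vertex.
    (∀ d : D, ∃ P : MvPolynomial (Fin (G.valence d + 1)) ℂ,
      ∀ (x₀ : ℂ) (y : Fin (G.valence d) → ℂ), x₀ ∉ L.lattice → (∀ j, y j ∉ L.lattice) →
        (∀ j, x₀ + y j - (α.val (G.star d j) - α.val (G.star d (j + 1))) ∉ L.lattice ∧
          x₀ - y j - (α.val (G.star d j) - α.val (G.star d (j + 1))) ∉ L.lattice) →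
        (DiscreteToda.todaProd L (G.valence d) (fun j => α.val (G.star d j)) x₀ y = 1 ↔
          MvPolynomial.eval
            (Fin.cons (L.weierstrassP x₀) (fun j => L.weierstrassP (y j)) :
              Fin (G.valence d + 1) → ℂ) P = 0)) ∧
    -- The transition matrices are unimodular, represent the Möbius transformations defined by Q4,
    -- and are mutually inverse (up to a scalar) on oppositely directed edges.
    (∀ (x : V → ℂ) (lam : ℂ) (d : D), DiscreteToda.RegularEdge L G α x d →
      DiscreteToda.AdmissibleEdge L G α lam d →
        (DiscreteToda.transition L G α x lam d).det = 1 ∧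
        (∀ u₁ u₃ : ℂ,
          DiscreteToda.Q4 L (L.weierstrassP (x (G.src d))) u₁ (L.weierstrassP (x (G.tgt d))) u₃
              (α.val d + lam) (α.val (G.rot d) + lam) = 0 ↔
            u₃ * (DiscreteToda.transition L G α x lam d 1 0 * u₁ +
                DiscreteToda.transition L G α x lam d 1 1) =
              DiscreteToda.transition L G α x lam d 0 0 * u₁ +
                DiscreteToda.transition L G α x lam d 0 1) ∧
        DiscreteToda.IsScalar (DiscreteToda.transition L G α x lam (G.rev d) *
          DiscreteToda.transition L G α x lam d)) ∧
    -- The Toda equation at a vertex is the triviality of the monodromy around it.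
    (∀ (x : V → ℂ) (lam : ℂ) (d : D), DiscreteToda.RegularStar L G α x d →
      DiscreteToda.AdmissibleStar L G α lam d →
        (DiscreteToda.TodaAt L G α x d ↔
          DiscreteToda.IsScalar (DiscreteToda.monodromy L G α x lam d))) ∧
    -- The Toda system is equivalent to the zero curvature condition.
    (∀ x : V → ℂ, (∀ d, DiscreteToda.RegularStar L G α x d) →
      ((∀ d, DiscreteToda.TodaAt L G α x d) ↔
        ∀ (lam : ℂ) (d : D), DiscreteToda.AdmissibleStar L G α lam d →
          DiscreteToda.IsScalar (DiscreteToda.monodromy L G α x lam d))) := by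
  refine ⟨fun d ↦ ?_, fun x lam d h ha ↦ ?_, fun x lam d h ha ↦ ?_, fun x h ↦ ?_⟩
  · have hδ : ∑ j : Fin (G.valence d), (α.val (G.star d j) - α.val (G.star d (j + 1))) = 0 := by
      rw [← Finset.sum_range (fun j ↦ α.val (G.star d j) - α.val (G.star d (j + 1))),
        Finset.sum_range_sub', DiscreteToda.star_valence]
      exact sub_self _
    exact DiscreteToda.exists_todaPolynomial L _ hδ
  · exact ⟨DiscreteToda.det_transition x lam d h ha,
      DiscreteToda.Q4_eq_zero_iff_transition x lam d h ha,
      DiscreteToda.isScalar_transition_rev_mul x lam d h ha⟩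
  · exact DiscreteToda.todaAt_iff_isScalar_monodromy x lam d h ha
  · refine ⟨fun hT lam d ha ↦ ?_, fun hM d ↦ ?_⟩
    · exact (DiscreteToda.todaAt_iff_isScalar_monodromy x lam d (h d) ha).mp (hT d)
    · obtain ⟨lam, ha⟩ := DiscreteToda.exists_admissibleStar L α d
      exact (DiscreteToda.todaAt_iff_isScalar_monodromy x lam d (h d) ha).mpr (hM lam d ha)
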